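/- For a sequence $\mu=\{\mu_k\}_{k\ge0}$ of complex numbers put $(\Delta\mu)_k=\mu_{k+1}-\mu_k$ and $w_k^{(n)}\{\mu\}=\binom nk(-1)^{n-k}(\Delta^{n-k}\mu)_k$ for $0\le k\le n$. Let $\{g_k\}_{k\ge0}$ be a sequence of complex numbers such that $f_k=k\,g_k$ ($k\ge0$; so $f_0=0$) satisfies the Hausdorff condition with $p=2$: there is $M>0$ with $(n+1)\sum_{k=0}^n|w_k^{(n)}\{f\}|^2<M$ for all $n\ge0$. A Carlsonian interpolation of $\{g_k\}_{k\ge1}$ is a function $F$ continuous on $\operatorname{Re}\lambda\ge\frac12$, holomorphic in $\operatorname{Re}\lambda>\frac12$, with $F(k)=g_k$ for $k=1,2,\dots$, and such that $|F(\lambda)|\le Ae^{B|\lambda|}$ for $\operatorname{Re}\lambda\ge\frac12$ and $|F(\frac12+i\nu)|\le A'e^{c|\nu|}$ for $\nu\in\mathbb R$, with some constants $A,B,A'$ and $c<\pi$. Let $\Xi=\{2k\pi+iv: k\in\mathbb Z,\ v>0\}$, with closure $\overline\Xi=\{2k\pi+iv: k\in\mathbb Z,\ v\ge0\}$. Then $\{g_k\}_{k\ge1}$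 has exactly one Carlsonian interpolation $\tilde g$ (on $\operatorname{Re}\lambda\ge\frac12$), and the following hold. 1. The series $\frac1{2\pi}\sum_{k\ge1}g_ke^{-ik\tau}$ converges uniformly on compact subsets of $\operatorname{Im}\tau<0$, and converges also at every real $\tau$; its sum $G$ is holomorphic in $\operatorname{Im}\tau<0$ and continuous on $\operatorname{Im}\tau\le0$. 2. $G$ extends to a function that is holomorphic on $\mathbb C\setminus\overline\Xi$ (in particular on the upper half-plane cut along $\Xi$) and continuous on $\mathbb C\setminus\Xi$. 3. For all $v\ge0$ and $k\in\mathbb Z$ the one-sided limits of $G(2k\pi\pm\varepsilon+iv)$ as $\varepsilon\to0^+$ exist, and the jump $J(v)=i\lim_{\varepsilon\to0^+}[G(2k\pi+\varepsilon+iv)-G(2k\pi-\varepsilon+iv)]$ does not depend on $k$. $J$ is continuous on $[0,\infty)$, and for all $\ell\ge\frac12$, $v\ge0$, $$|J(v)|\le\|\tilde g_\ell\|_1e^{\ell v},\qquad \|\tilde g_\ell\|_1=\frac1{2\pi}\int_{-\infty}^{\infty}|\tilde g(\ell+i\nu)|\,d\nu<\infty.$$ 4. $J(v)=o(e^{v/2})$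 as $v\to+\infty$, and $J(0)=0$. 5. $J(v)=\dfrac{e^{v/2}}{2\pi}\displaystyle\int_{-\infty}^{\infty}\tilde g(\tfrac12+i\nu)e^{i\nu v}\,d\nu$ for $v\ge0$. 6. For $\operatorname{Re}\lambda>\frac12$ the Laplace transform $\tilde J(\lambda)=\int_0^\infty J(v)e^{-\lambda v}\,dv$ converges absolutely, is holomorphic, and equals $\tilde g(\lambda)$. 7. For all $\ell\ge\frac12$, $\displaystyle\int_{-\infty}^{\infty}|\tilde g(\ell+i\nu)|^2\,d\nu=2\pi\int_0^\infty|J(v)e^{-\ell v}|^2\,dv$, both integrals being finite. -/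

import Mathlib

open Real Set Filter Topology MeasureTheory Asymptotics

noncomputable section

/-- The Bernstein weights `w_k^{(n)}{μ} = (n choose k) (-1)^{n-k} (Δ^{n-k} μ)_k` (used for
`k ≤ n`) of a sequence `μ`, where `(Δ μ)_k = μ_{k+1} - μ_k`. -/
def bernsteinWeight (μ : ℕ → ℂ) (n k : ℕ) : ℂ :=
  (n.choose k : ℂ) * (-1) ^ (n - k) * (fwdDiff 1)^[n - k] μ k

/-- The Hausdorff condition with exponent `p`: for some constant `M > 0` and all `n`,
`(n+1)^{p-1} ∑_{k=0}^n |w_k^{(n)}{μ}|^p < M`. -/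
def HausdorffCondition (p : ℝ) (μ : ℕ → ℂ) : Prop :=
  ∃ M : ℝ, 0 < M ∧ ∀ n : ℕ,
    ((n : ℝ) + 1) ^ (p - 1) * ∑ k ∈ Finset.range (n + 1), ‖bernsteinWeight μ n k‖ ^ p < M

/-- `F` is a Carlsonian interpolation of `g` on the half-plane `Re z ≥ a`: it takes the values
`g k` at the natural numbers `k > a`, is holomorphic in the open half-plane, continuous on the
closed one, and obeys the growth conditions of Carlson's theorem (exponential type in the
half-plane, and exponential type less than `π` on the boundary line). -/
structure IsCarlsonianInterpolation (a : ℝ) (g : ℕ → ℂ) (F : ℂ → ℂ) : Prop where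
  interpolates : ∀ k : ℕ, a < k → F k = g k
  holomorphic : DifferentiableOn ℂ F {z : ℂ | a < z.re}
  continuous : ContinuousOn F {z : ℂ | a ≤ z.re}
  expType : ∃ A B : ℝ, ∀ z : ℂ, a ≤ z.re → ‖F z‖ ≤ A * Real.exp (B * ‖z‖)
  boundary : ∃ A c : ℝ, c < π ∧ ∀ y : ℝ, ‖F (a + y * Complex.I)‖ ≤ A * Real.exp (c * |y|)

/-- The partial sum `(1/2π) ∑_{k=1}^n g_k e^{-ikτ}`. -/
def trigPartialSum (g : ℕ → ℂ) (n : ℕ) (τ : ℂ) : ℂ :=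
  1 / (2 * (π : ℂ)) * ∑ k ∈ Finset.Icc 1 n, g k * Complex.exp (-Complex.I * k * τ)

/-- The union of the (open) cuts `kβ + i v`, `v > 0`, `k ∈ ℤ`. -/
def upperCuts (β : ℝ) : Set ℂ :=
  {τ | ∃ (k : ℤ) (v : ℝ), 0 < v ∧ τ = (k : ℂ) * β + v * Complex.I}

/-- The cuts together with their endpoints: `kβ + i v`, `v ≥ 0`, `k ∈ ℤ`. -/
def closedUpperCuts (β : ℝ) : Set ℂ :=
  {τ | ∃ (k : ℤ) (v : ℝ), 0 ≤ v ∧ τ = (k : ℂ) * β + v * Complex.I}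

/-- The normalised `L¹` norm `(1/2π) ∫ |F(ℓ + iν)| dν` along the line `Re = ℓ`. -/
def lineNorm (F : ℂ → ℂ) (l : ℝ) : ℝ :=
  1 / (2 * π) * ∫ ν : ℝ, ‖F (l + ν * Complex.I)‖

/-- The Laplace transform `∫_0^∞ J(v) e^{-zv} dv`. -/
def laplaceTransform (J : ℝ → ℂ) (z : ℂ) : ℂ :=
  ∫ v in Ioi (0 : ℝ), J v * Complex.exp (-z * v)

end

/-! With x = e^{-v}, the Hausdorff condition with p = 2 makes f the moment sequence of an L²
function on (0,1). Hence f_k = ∫ u(v) e^{-kv} dv for some u in L¹ ∩ L² supported on (0,∞)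
(`HausdorffCondition.exists_laplace`). The proof is by duality: f is a combination of its Bernstein
weights, so Cauchy–Schwarz bounds |∑ a_m f_m|² by M times a discrete mean square, which tends to the
squared L² norm of ∑ a_m x^m (`norm_moment_le_of_gram`). Hahn–Banach and Riesz then produce u.

This u determines everything. J is its primitive vanishing at 0 and g̃ is the Laplace transform of
J. By Fubini z g̃(z) = ∫ u(v) e^{-zv} dv, so g̃(k) = g_k and g̃ is bounded on Re z ≥ 1/2; uniqueness
is Carlson's theorem (`carlson_eqOn_zero`).

Put q = e^{-iτ}. Since ∑ q^k e^{-ks}/k = -log(1 - e^{-s}q), the series sums to G(τ) = -(1/2π) ∫ u(s)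
log(1 - e^{-s}q) ds. The kernel has only a logarithmic singularity, which u in L² tolerates; this
gives absolute convergence up to |q| = 1 and a meaning to the integral for |q| > 1. It is
holomorphic off q ∈ [1,∞), whose preimage is the closed cuts, and continuous at q = 1
(`continuousAt_logIntegral_one`). Across a cut at height v the logarithm jumps by 2πi exactly when s
< v, so the jump of G is ∫_0^v u = J(v) (`exists_jump_trigExtension`).

On a line Re z = l > 0, z g̃(z) is the Fourier transform of u e^{-lv}, hence in L²; dividing by z
makes g̃ integrable. Fourier inversion gives the formula for J and its bound, and Plancherel for J
e^{-lv} gives the L² identity. Finally J is bounded because u is integrable, which is more than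
o(e^{v/2}). -/

/-! ### The Fourier transform on L¹ ∩ L². -/

open FourierTransform SchwartzMap in
/-- On `L¹ ∩ L²` the Fourier integral agrees with the `L²` Fourier transform. -/
theorem fourier_ae_eq_Lp_fourier {f : ℝ → ℂ} (hf : Integrable f) (hf2 : MemLp f 2) :
    𝓕 f =ᵐ[volume] (𝓕 hf2.toLp : Lp (α := ℝ) ℂ 2) := by
  have hc : Continuous (𝓕 f) :=
    VectorFourier.fourierIntegral_continuous Real.continuous_fourierChar
      (by exact continuous_inner) hf
  -- Both sides are locally integrable, so it suffices to test against smooth compactly supported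
  -- functions. These are Schwartz, and on each side the transform can be moved onto the test
  -- function.
  refine ae_eq_of_integral_contDiff_smul_eq hc.locallyIntegrable
    ((Lp.memLp _).locallyIntegrable (by norm_num)) fun φ hφ hφc => ?_
  have hs : ContDiff ℝ ((⊤ : ℕ∞) : WithTop ℕ∞) fun x => (φ x : ℂ) :=
    Complex.ofRealCLM.contDiff.comp hφ
  have hsc : HasCompactSupport fun x => (φ x : ℂ) := hφc.comp_left Complex.ofReal_zero
  set ψ : 𝓢(ℝ, ℂ) := hsc.toSchwartzMap hs with hψ
  have hψx : ∀ x, ψ x = φ x := fun x => rfl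
  have h1 := congrArg (fun T : 𝓢'(ℝ, ℂ) => T ψ) (Lp.fourier_toTemperedDistribution_eq hf2.toLp)
  simp only [TemperedDistribution.fourier_apply, Lp.toTemperedDistribution_apply] at h1
  have h2 : ∫ x, 𝓕 (ψ : ℝ → ℂ) x • f x = ∫ x, ψ x • 𝓕 f x := by
    have := VectorFourier.integral_fourierIntegral_smul_eq_flip (L := innerₗ ℝ) (e := Real.fourierChar)
      (μ := volume) (ν := volume) Real.continuous_fourierChar
      (by exact continuous_inner) ψ.integrable hf
    rw [flip_innerₗ] at this
    exact this
  have h3 : ∫ x, (𝓕 ψ) x • (hf2.toLp : ℝ → ℂ) x = ∫ x, 𝓕 (ψ : ℝ → ℂ) x • f x := by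
    refine integral_congr_ae ?_
    filter_upwards [hf2.coeFn_toLp] with x hx
    rw [hx, SchwartzMap.fourier_coe]
  rw [h3, h2] at h1
  simpa [hψx] using h1

open FourierTransform in
/-- Plancherel's theorem on `L¹ ∩ L²`. -/
theorem memLp_two_fourier {f : ℝ → ℂ} (hf : Integrable f) (hf2 : MemLp f 2) :
    MemLp (𝓕 f) 2 ∧ ∫ x, ‖𝓕 f x‖ ^ 2 = ∫ x, ‖f x‖ ^ 2 := by
  have hae := fourier_ae_eq_Lp_fourier hf hf2
  have hm : MemLp (𝓕 f) 2 := (memLp_congr_ae hae).2 (Lp.memLp _)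
  refine ⟨hm, ?_⟩
  have key : ∀ {h : ℝ → ℂ} (hh : MemLp h 2 volume), ∫ x, ‖h x‖ ^ 2 = ‖hh.toLp‖ ^ 2 := by
    intro h hh
    rw [← @inner_self_eq_norm_sq ℂ, L2.inner_def, ← integral_re (L2.integrable_inner _ _)]
    refine integral_congr_ae ?_
    filter_upwards [hh.coeFn_toLp] with x hx
    rw [hx, inner_self_eq_norm_sq]
  have h2 := Lp.ext (hm.coeFn_toLp.trans hae)
  rw [key hm, key hf2, h2, Lp.norm_fourier_eq]

/-! ### Carlson's theorem. -/

/-- Division by `sin πz`: a holomorphic function vanishing at the integers of an open set is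
`sin πz` times a holomorphic function. -/
theorem exists_eq_sin_pi_mul {U : Set ℂ} (hU : IsOpen U) {F : ℂ → ℂ} (hF : DifferentiableOn ℂ F U)
    (h0 : ∀ z ∈ U, Complex.sin (π * z) = 0 → F z = 0) :
    ∃ φ : ℂ → ℂ, DifferentiableOn ℂ φ U ∧ (∀ z ∈ U, F z = Complex.sin (π * z) * φ z) ∧
      ∀ z, Complex.sin (π * z) ≠ 0 → φ z = F z / Complex.sin (π * z) := by
  classical
  set S : ℂ → ℂ := fun z => Complex.sin (π * z) with hS
  set S' : ℂ → ℂ := fun z => Complex.cos (π * z) * π with hS'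
  have hSd : ∀ z, HasDerivAt S (S' z) z := fun z => by
    simpa using ((hasDerivAt_id z).const_mul (π : ℂ)).csin
  have hS'0 : ∀ z, S z = 0 → S' z ≠ 0 := by
    intro z hz h
    have hpi : (π : ℂ) ≠ 0 := Complex.ofReal_ne_zero.2 Real.pi_ne_zero
    have hcos : Complex.cos (π * z) = 0 := by
      simpa [hS', hpi] using h
    have := Complex.sin_sq_add_cos_sq (π * z)
    rw [hcos, show Complex.sin (π * z) = 0 from hz] at this
    simp at this
  -- At a zero of the sine, which is simple, the value is the limit of the quotient given by the
  -- ratio of derivatives; continuity there makes the singularity removable.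
  set φ : ℂ → ℂ := fun z => if S z = 0 then deriv F z / S' z else F z / S z with hφ
  refine ⟨φ, ?_, ?_, fun z hz => by simp [hφ, hS, hz]⟩
  · intro z hz
    have hev : ∀ w, S w ≠ 0 → φ =ᶠ[𝓝 w] fun y => F y / S y := by
      intro w hw
      have : ∀ᶠ y in 𝓝 w, S y ≠ 0 := (hSd w).continuousAt.eventually_ne hw
      filter_upwards [this] with y hy
      simp [hφ, hy]
    have hdiff : ∀ w ∈ U, S w ≠ 0 → DifferentiableAt ℂ φ w := by
      intro w hw hw0
      exact (((hF.differentiableAt (hU.mem_nhds hw)).div (hSd w).differentiableAt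
        hw0).congr_of_eventuallyEq (hev w hw0))
    by_cases hz0 : S z = 0
    · have hne : ∀ᶠ y in 𝓝[≠] z, S y ≠ 0 := (hSd z).eventually_ne (hS'0 z hz0)
      have hcont : ContinuousAt φ z := by
        rw [continuousAt_iff_punctured_nhds]
        have hFd := (hF.differentiableAt (hU.mem_nhds hz)).hasDerivAt
        have h1 := hasDerivAt_iff_tendsto_slope.1 hFd
        have h2 := hasDerivAt_iff_tendsto_slope.1 (hSd z)
        have h3 := h1.div h2 (hS'0 z hz0)
        have hφz : φ z = deriv F z / S' z := by simp [hφ, hz0]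
        rw [hφz]
        refine h3.congr' ?_
        filter_upwards [hne, self_mem_nhdsWithin] with y hy hyz
        have hyz' : y - z ≠ 0 := sub_ne_zero.2 hyz
        have hFz : F z = 0 := h0 z hz hz0
        simp only [Pi.div_apply, slope_def_field, hφ, hy, if_false, hFz, hz0, sub_zero]
        field_simp
      refine (Complex.analyticAt_of_differentiable_on_punctured_nhds_of_continuousAt ?_
        hcont).differentiableAt.differentiableWithinAt
      filter_upwards [hne, mem_nhdsWithin_of_mem_nhds (hU.mem_nhds hz)] with y hy hyU
      exact hdiff y hyU hy
    · exact (hdiff z hz hz0).differentiableWithinAt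
  · intro z hz
    by_cases hz0 : S z = 0
    · rw [h0 z hz hz0, show Complex.sin (π * z) = 0 from hz0, zero_mul]
    · have : φ z = F z / S z := by simp [hφ, hz0]
      rw [this, ← mul_div_assoc, mul_div_cancel_left₀]
      exact hz0

theorem sq_norm_sin (x y : ℝ) :
    ‖Complex.sin (x + y * Complex.I)‖ ^ 2 = Real.sin x ^ 2 + Real.sinh y ^ 2 := by
  rw [← Complex.normSq_eq_norm_sq, Complex.sin_add_mul_I, Complex.normSq_apply]
  simp only [← Complex.ofReal_sin, ← Complex.ofReal_cos, ← Complex.ofReal_cosh,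
    ← Complex.ofReal_sinh, Complex.add_re, Complex.add_im, Complex.mul_re, Complex.mul_im,
    Complex.ofReal_re, Complex.ofReal_im, Complex.I_re, Complex.I_im]
  have h1 := Real.sin_sq_add_cos_sq x
  have h2 := Real.cosh_sq y
  ring_nf
  rw [h2]
  nlinarith [h1]

/-- Away from the integers `|sin πz|` is bounded below. -/
theorem le_norm_sin_of_le_dist {z : ℂ} (hz : ∀ k : ℤ, 1 / 4 ≤ ‖z - k‖) :
    1 / 4 ≤ ‖Complex.sin (π * z)‖ := by
  set k := round z.re
  set x := z.re - k with hx
  have hx2 : |x| ≤ 1 / 2 := abs_sub_round z.re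
  have hre : (z - k).re = x := by simp [hx]
  have him : (z - k).im = z.im := by simp
  have hk := hz k
  have hn : ‖z - k‖ ^ 2 = x ^ 2 + z.im ^ 2 := by
    rw [← Complex.normSq_eq_norm_sq, Complex.normSq_apply, hre, him]; ring
  have hxy : 1 / 16 ≤ x ^ 2 + z.im ^ 2 := by rw [← hn]; nlinarith
  have hsin : Real.sin (π * z.re) ^ 2 = Real.sin (π * x) ^ 2 := by
    have : π * z.re = π * x + k * π := by rw [hx]; ring
    rw [this, Real.sin_add_int_mul_pi, mul_pow, ← zpow_natCast, ← zpow_mul]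
    rw [zpow_mul, mul_comm]
    have : ((-1 : ℝ) ^ k) ^ (2 : ℤ) = 1 := by
      rw [← zpow_mul, mul_comm, zpow_mul]; simp
    simp [this]
  -- Jordan's inequality gives |sin πx| ≥ 2|x| for |x| ≤ 1/2, which is more than needed.
  have h1 : x ^ 2 ≤ Real.sin (π * x) ^ 2 := by
    have h3 : |2 / π * (π * x)| ≤ |Real.sin (π * x)| := by
      have hh : |π * x| ≤ π / 2 := by
        rw [abs_mul, abs_of_pos Real.pi_pos]; nlinarith [Real.pi_pos]
      have := Real.mul_abs_le_abs_sin hh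
      rw [abs_mul, abs_of_pos (by positivity)]
      exact this
    have h4 : 2 / π * (π * x) = 2 * x := by field_simp
    rw [h4] at h3
    have := sq_le_sq.2 h3
    nlinarith [sq_nonneg x]
  have h2 : z.im ^ 2 ≤ Real.sinh (π * z.im) ^ 2 := by
    apply sq_le_sq.2
    rw [Real.abs_sinh]
    have : |z.im| ≤ |π * z.im| := by
      rw [abs_mul, abs_of_pos Real.pi_pos]
      nlinarith [Real.pi_gt_three, abs_nonneg z.im]
    exact this.trans (Real.self_le_sinh_iff.2 (abs_nonneg _))
  have h5 := sq_norm_sin (π * z.re) (π * z.im)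
  have h6 : ((π * z.re : ℝ) : ℂ) + ((π * z.im : ℝ) : ℂ) * Complex.I = π * z := by
    conv_rhs => rw [← Complex.re_add_im z]
    push_cast; ring
  rw [h6, hsin] at h5
  nlinarith [norm_nonneg (Complex.sin (π * z))]

/-- On this line sin² of the real part is 1, so the modulus of the sine is cosh πy. This is the
growth against which the boundary rate c < π is measured. -/
theorem exp_le_norm_sin_of_re_eq_half {z : ℂ} (hz : z.re = 1 / 2) :
    Real.exp (π * |z.im|) / 2 ≤ ‖Complex.sin (π * z)‖ := by
  have h5 := sq_norm_sin (π * z.re) (π * z.im)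
  have h6 : ((π * z.re : ℝ) : ℂ) + ((π * z.im : ℝ) : ℂ) * Complex.I = π * z := by
    conv_rhs => rw [← Complex.re_add_im z]
    push_cast; ring
  rw [h6, hz, show π * (1 / 2) = π / 2 by ring, Real.sin_pi_div_two] at h5
  have h7 : ‖Complex.sin (π * z)‖ ^ 2 = Real.cosh (π * z.im) ^ 2 := by
    rw [h5, Real.cosh_sq]; ring
  have h8 : ‖Complex.sin (π * z)‖ = Real.cosh (π * z.im) :=
    (sq_eq_sq₀ (norm_nonneg _) (Real.cosh_pos _).le).1 h7
  rw [h8, ← Real.cosh_abs, abs_mul, abs_of_pos Real.pi_pos, Real.cosh_eq]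
  have := Real.exp_pos (-(π * |z.im|))
  linarith

/-- At distance at least 1/4 from the integers the sine is at least 1/4. Inside a disc of radius 1/4
about an integer the maximum principle carries over the bound from the circle, at the cost of the
extra 1/2 in the exponent. Such an integer is at least 1, so the disc stays in the open half-plane.
-/
theorem norm_quotient_sin_le {F φ : ℂ → ℂ} {A B : ℝ} (hA : 0 ≤ A) (hB : 0 ≤ B)
    (hF : ∀ z : ℂ, 1 / 2 ≤ z.re → ‖F z‖ ≤ A * Real.exp (B * ‖z‖))
    (hφd : DifferentiableOn ℂ φ {z : ℂ | 1 / 2 < z.re})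
    (hφ : ∀ z, Complex.sin (π * z) ≠ 0 → φ z = F z / Complex.sin (π * z))
    {z : ℂ} (hz : 1 / 2 ≤ z.re) :
    ‖φ z‖ ≤ 4 * A * Real.exp (B * (‖z‖ + 1 / 2)) := by
  have far : ∀ w : ℂ, 1 / 2 ≤ w.re → (∀ k : ℤ, 1 / 4 ≤ ‖w - k‖) →
      ‖φ w‖ ≤ 4 * A * Real.exp (B * ‖w‖) := by
    intro w hw hk
    have h1 := le_norm_sin_of_le_dist hk
    have h2 : 0 < ‖Complex.sin (π * w)‖ := by linarith
    rw [hφ w (norm_pos_iff.1 h2), norm_div, div_le_iff₀ h2]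
    have h3 := hF w hw
    have h4 := mul_nonneg hA (Real.exp_pos (B * ‖w‖)).le
    nlinarith
  by_cases hk : ∀ k : ℤ, 1 / 4 ≤ ‖z - k‖
  · refine (far z hz hk).trans ?_
    gcongr
    linarith
  · push Not at hk
    obtain ⟨k, hk⟩ := hk
    have hk1 : (1 : ℝ) ≤ k := by
      have h1 := (Complex.abs_re_le_norm (z - k)).trans_lt hk
      have h2 : (z - k).re = z.re - k := by simp
      rw [h2, abs_lt] at h1
      have h3 : (0 : ℝ) < k := by linarith
      exact_mod_cast (Int.cast_pos.1 h3 : 0 < k)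
    have hball : Metric.closedBall (k : ℂ) (1 / 4) ⊆ {z : ℂ | 1 / 2 < z.re} := by
      intro w hw
      rw [mem_closedBall_iff_norm] at hw
      have h1 := (Complex.abs_re_le_norm (w - k)).trans hw
      have h2 : (w - k).re = w.re - k := by simp
      rw [h2, abs_le] at h1
      simp only [Set.mem_ofPred_eq]
      linarith
    have hdc : DiffContOnCl ℂ φ (Metric.ball (k : ℂ) (1 / 4)) :=
      (hφd.mono hball).diffContOnCl_ball subset_rfl
    refine Complex.norm_le_of_forall_mem_frontier_norm_le Metric.isBounded_ball hdc ?_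
      (subset_closure (mem_ball_iff_norm.2 hk))
    intro w hw
    rw [frontier_ball _ (by norm_num), mem_sphere_iff_norm] at hw
    have hwU : w ∈ {z : ℂ | 1 / 2 < z.re} := hball (mem_closedBall_iff_norm.2 hw.le)
    refine (far w (le_of_lt hwU) fun j => ?_).trans ?_
    · by_cases hj : j = k
      · rw [hj, hw]
      · have h1 : (1 : ℝ) ≤ ‖(k : ℂ) - j‖ := by
          rw [← Int.cast_sub, Complex.norm_intCast]
          have : (1 : ℤ) ≤ |k - j| := Int.one_le_abs (sub_ne_zero.2 (Ne.symm hj))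
          exact_mod_cast this
        have h2 : ‖(k : ℂ) - j‖ ≤ ‖w - j‖ + ‖w - k‖ := by
          calc ‖(k : ℂ) - j‖ = ‖(w - j) - (w - k)‖ := by congr 1; ring
            _ ≤ _ := norm_sub_le _ _
        linarith
    · gcongr
      have : ‖w‖ ≤ ‖z‖ + ‖w - z‖ := by
        calc ‖w‖ = ‖z + (w - z)‖ := by congr 1; ring
          _ ≤ _ := norm_add_le _ _
      have h2 : ‖w - z‖ ≤ ‖w - k‖ + ‖z - k‖ := by
        calc ‖w - z‖ = ‖(w - k) - (z - k)‖ := by congr 1; ring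
          _ ≤ _ := norm_sub_le _ _
      linarith

/-- Any exponent below 1 would serve: it keeps w log(w + 1) of order less than 2, as
Phragmén–Lindelöf requires. -/
theorem norm_log_one_add_le {w : ℂ} (hw : 0 ≤ w.re) (h1 : 1 ≤ ‖w‖) :
    ‖Complex.log (w + 1)‖ ≤ 8 * ‖w‖ ^ (1 / 2 : ℝ) := by
  have hle : 1 ≤ ‖w + 1‖ := by
    have := Complex.re_le_norm (w + 1)
    simp only [Complex.add_re, Complex.one_re] at this
    linarith
  have h2 : ‖w + 1‖ ≤ 2 * ‖w‖ := (norm_add_le _ _).trans (by simp; linarith)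
  rw [← Real.sqrt_eq_rpow]
  set r := Real.sqrt ‖w‖
  have hr1 : 1 ≤ r := Real.one_le_sqrt.2 h1
  have hr2 : r * r = ‖w‖ := Real.mul_self_sqrt (norm_nonneg _)
  have h3 : Real.log ‖w + 1‖ ≤ 4 * r := by
    have ha : Real.log ‖w + 1‖ ≤ Real.log ((2 * r) * (2 * r)) :=
      Real.log_le_log (by linarith) (by nlinarith)
    rw [Real.log_mul (by positivity) (by positivity)] at ha
    have := Real.log_le_self (show (0 : ℝ) ≤ 2 * r by positivity)
    linarith
  have h4 : ‖Complex.log (w + 1)‖ ≤ |Real.log ‖w + 1‖| + |Complex.arg (w + 1)| := by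
    have := Complex.norm_le_abs_re_add_abs_im (Complex.log (w + 1))
    simpa [Complex.log_re, Complex.log_im] using this
  have h5 := Complex.abs_arg_le_pi (w + 1)
  rw [abs_of_nonneg (Real.log_nonneg hle)] at h4
  linarith [Real.pi_lt_four]

/-- **Carlson's theorem** in the half-plane `Re z ≥ 1/2`. -/
theorem carlson_eqOn_zero {F : ℂ → ℂ} (hd : DifferentiableOn ℂ F {z : ℂ | 1 / 2 < z.re})
    (hc : ContinuousOn F {z : ℂ | 1 / 2 ≤ z.re})
    (hexp : ∃ A B : ℝ, ∀ z : ℂ, 1 / 2 ≤ z.re → ‖F z‖ ≤ A * Real.exp (B * ‖z‖))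
    (hb : ∃ A c : ℝ, c < π ∧ ∀ y : ℝ, ‖F (1 / 2 + y * Complex.I)‖ ≤ A * Real.exp (c * |y|))
    (h0 : ∀ k : ℕ, 1 ≤ k → F k = 0) : EqOn F 0 {z : ℂ | 1 / 2 ≤ z.re} := by
  obtain ⟨A, B, hA, hB, hF⟩ : ∃ A B : ℝ, 0 ≤ A ∧ 0 ≤ B ∧
      ∀ z : ℂ, 1 / 2 ≤ z.re → ‖F z‖ ≤ A * Real.exp (B * ‖z‖) := by
    obtain ⟨A, B, h⟩ := hexp
    refine ⟨|A|, |B|, abs_nonneg _, abs_nonneg _, fun z hz => (h z hz).trans ?_⟩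
    gcongr
    · exact le_abs_self A
    · exact le_abs_self B
  obtain ⟨A', c, hcπ, hF'⟩ := hb
  have hUo : IsOpen {z : ℂ | 1 / 2 < z.re} := isOpen_lt continuous_const Complex.continuous_re
  have hpi : (π : ℂ) ≠ 0 := Complex.ofReal_ne_zero.2 Real.pi_ne_zero
  obtain ⟨φ, hφd, hφ1, hφ2⟩ := exists_eq_sin_pi_mul hUo hd (fun z hz hs => by
    obtain ⟨k, hk⟩ := Complex.sin_eq_zero_iff.1 hs
    have hzk : z = k := by
      rw [mul_comm] at hk
      exact mul_right_cancel₀ hpi hk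
    have hk0 : (0 : ℝ) < k := by
      rw [Set.mem_ofPred_eq, hzk] at hz
      simp only [Complex.intCast_re] at hz
      linarith
    have hk0 : 0 < k := Int.cast_pos.1 hk0
    lift k to ℕ using hk0.le
    rw [hzk]
    have := h0 k (by omega)
    simpa using this)
  have hbd : ∀ z : ℂ, z.re = 1 / 2 → Complex.sin (π * z) ≠ 0 := fun z hz => by
    have h1 := exp_le_norm_sin_of_re_eq_half hz
    have h2 := Real.exp_pos (π * |z.im|)
    exact norm_pos_iff.1 (by linarith)
  have hφ1' : ∀ z : ℂ, 1 / 2 ≤ z.re → F z = Complex.sin (π * z) * φ z := by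
    intro z hz
    rcases hz.lt_or_eq with h | h
    · exact hφ1 z h
    · rw [hφ2 z (hbd z h.symm), mul_div_cancel₀ _ (hbd z h.symm)]
  have hφc : ContinuousOn φ {z : ℂ | 1 / 2 ≤ z.re} := by
    intro z hz
    rcases (show 1 / 2 ≤ z.re from hz).lt_or_eq with h | h
    · exact ((hφd.differentiableAt (hUo.mem_nhds h)).continuousAt).continuousWithinAt
    · have hsc : Continuous fun w : ℂ => Complex.sin (π * w) := by fun_prop
      have hne := hsc.continuousAt.eventually_ne (hbd z h.symm)
      have : ContinuousWithinAt (fun w => F w / Complex.sin (π * w)) {z : ℂ | 1 / 2 ≤ z.re} z :=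
        (hc z hz).div hsc.continuousWithinAt (hbd z h.symm)
      refine this.congr_of_eventuallyEq ?_ (hφ2 z (hbd z h.symm))
      filter_upwards [mem_nhdsWithin_of_mem_nhds hne] with w hw
      exact hφ2 w hw
  have hgrow : ∀ w : ℂ, 0 ≤ w.re → ‖φ (w + 1 / 2)‖ ≤ 4 * A * Real.exp (B * (‖w‖ + 1)) := by
    intro w hw
    refine (norm_quotient_sin_le hA hB hF hφd hφ2 (z := w + 1 / 2) (by simp; linarith)).trans ?_
    refine mul_le_mul_of_nonneg_left (Real.exp_le_exp.2 (mul_le_mul_of_nonneg_left ?_ hB))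
      (by positivity)
    have : ‖w + 1 / 2‖ ≤ ‖w‖ + 1 / 2 := (norm_add_le _ _).trans (by simp)
    linarith
  -- Chosen so that aπ/2 = π - c. On the imaginary axis the factor e^{-aw log(w+1)} grows at most
  -- like e^{a|y|π/2}, exactly cancelling the decay e^{(c-π)|y|} of the quotient, while on the
  -- positive axis it decays faster than any exponential.
  set a : ℝ := 2 * (π - c) / π with ha
  have ha0 : 0 < a := by have := Real.pi_pos; have : 0 < π - c := by linarith
                         positivity
  set ψ : ℂ → ℂ := fun w => φ (w + 1 / 2) * Complex.exp (-a * w * Complex.log (w + 1)) with hψ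
  have hslit : ∀ w : ℂ, 0 ≤ w.re → w + 1 ∈ Complex.slitPlane := fun w hw =>
    Or.inl (by simp; linarith)
  have hψd : DiffContOnCl ℂ ψ {z | 0 < z.re} := by
    refine ⟨?_, ?_⟩
    · intro w hw
      have hw' : 0 < w.re := hw
      have h1 : DifferentiableAt ℂ (fun w => φ (w + 1 / 2)) w :=
        DifferentiableAt.comp w (hφd.differentiableAt (hUo.mem_nhds (by simp; linarith)))
          (by fun_prop)
      have h2 : DifferentiableAt ℂ (fun w => Complex.log (w + 1)) w :=
        (differentiableAt_id.add_const 1).clog (hslit w hw'.le)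
      exact (h1.mul (((differentiableAt_const _).mul differentiableAt_id).mul
        h2).cexp).differentiableWithinAt
    · rw [Complex.closure_setOfPred_lt_re]
      refine ContinuousOn.mul ?_ ?_
      · exact hφc.comp (by fun_prop) fun w hw => by
          have : 0 ≤ w.re := hw
          simp only [Set.mem_ofPred_eq, Complex.add_re]
          norm_num
          linarith
      · refine ContinuousOn.cexp (ContinuousOn.mul (by fun_prop) ?_)
        exact ContinuousOn.clog (by fun_prop) fun w hw => hslit w hw
  have hψ0 := PhragmenLindelof.eq_zero_on_right_half_plane_of_superexponential_decay hψd ?_ ?_ ?_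
  · intro z hz
    have hz' : 1 / 2 ≤ z.re := hz
    have h1 := hψ0 (x := z - 1 / 2) (by simp; linarith)
    simp only [hψ, Pi.zero_apply, mul_eq_zero, Complex.exp_ne_zero, or_false,
      sub_add_cancel] at h1
    rw [hφ1' z hz', h1, mul_zero, Pi.zero_apply]
  -- Growth of order 3/2 < 2 in the half-plane: 2B absorbs the exponential type and 8a the
  -- logarithmic factor.
  · refine ⟨3 / 2, by norm_num, 2 * B + 8 * a, ?_⟩
    refine IsBigO.of_bound (4 * A) ?_
    have hlarge : ∀ᶠ w : ℂ in Bornology.cobounded ℂ, 1 ≤ ‖w‖ :=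
      tendsto_norm_cobounded_atTop.eventually_ge_atTop 1
    filter_upwards [hlarge.filter_mono inf_le_left, mem_inf_of_right (mem_principal_self _)]
      with w hw1 hw2
    have hw2 : 0 < w.re := hw2
    rw [hψ, norm_mul, Complex.norm_exp, Real.norm_eq_abs, abs_of_pos (Real.exp_pos _)]
    have h1 : (-a * w * Complex.log (w + 1)).re ≤ a * ‖w‖ * (8 * ‖w‖ ^ (1 / 2 : ℝ)) := by
      refine (Complex.re_le_norm _).trans ?_
      rw [norm_mul, norm_mul, norm_neg, Complex.norm_real, Real.norm_of_nonneg ha0.le]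
      gcongr
      exact norm_log_one_add_le hw2.le hw1
    have h2 : ‖w‖ ^ (3 / 2 : ℝ) = ‖w‖ * ‖w‖ ^ (1 / 2 : ℝ) := by
      rw [show (3 / 2 : ℝ) = 1 + 1 / 2 by norm_num, Real.rpow_add (by linarith), Real.rpow_one]
    have h3 : 1 ≤ ‖w‖ ^ (1 / 2 : ℝ) := Real.one_le_rpow hw1 (by norm_num)
    calc _ ≤ 4 * A * Real.exp (B * (‖w‖ + 1)) * Real.exp (a * ‖w‖ * (8 * ‖w‖ ^ (1 / 2 : ℝ))) := by
          gcongr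
          exact hgrow w hw2.le
      _ = 4 * A * Real.exp (B * (‖w‖ + 1) + a * ‖w‖ * (8 * ‖w‖ ^ (1 / 2 : ℝ))) := by
          rw [mul_assoc, ← Real.exp_add]
      _ ≤ _ := by
          gcongr
          rw [h2]
          have h4 : B * (‖w‖ + 1) ≤ 2 * B * (‖w‖ * ‖w‖ ^ (1 / 2 : ℝ)) := by
            have : ‖w‖ + 1 ≤ 2 * (‖w‖ * ‖w‖ ^ (1 / 2 : ℝ)) := by nlinarith
            nlinarith
          linarith
  -- Superexponential decay on the positive axis: once a log(x + 1) ≥ n + B + 1, the product is at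
  -- most a constant times e^{-x}.
  · intro n
    have hlim : Tendsto (fun x : ℝ => 4 * A * Real.exp B * Real.exp (-x)) atTop (𝓝 0) := by
      simpa using (Real.tendsto_exp_neg_atTop_nhds_zero).const_mul (4 * A * Real.exp B)
    refine squeeze_zero' (Eventually.of_forall fun x => by positivity) ?_ hlim
    have hlog : ∀ᶠ x : ℝ in atTop, (n + B + 1) / a ≤ Real.log (x + 1) :=
      (Real.tendsto_log_atTop.comp (tendsto_atTop_add_const_right _ 1 tendsto_id)).eventually_ge_atTop _
    filter_upwards [hlog, eventually_ge_atTop 0] with x hx hx0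
    have h1 : (-(a : ℂ) * x * Complex.log (x + 1)).re = -(a * x * Real.log (x + 1)) := by
      rw [show (x : ℂ) + 1 = ((x + 1 : ℝ) : ℂ) by push_cast; rfl,
        ← Complex.ofReal_log (by linarith), ← Complex.ofReal_neg, ← Complex.ofReal_mul,
        ← Complex.ofReal_mul, Complex.ofReal_re]
      ring
    have h2 : n + B + 1 ≤ a * Real.log (x + 1) := by
      rw [div_le_iff₀ ha0] at hx; linarith
    rw [hψ, norm_mul, Complex.norm_exp, h1, ← Real.exp_nat_mul]
    calc _ ≤ Real.exp (n * x) * (4 * A * Real.exp (B * (‖(x : ℂ)‖ + 1)) *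
          Real.exp (-(a * x * Real.log (x + 1)))) := by
          gcongr
          exact hgrow x (by simpa using hx0)
      _ = 4 * A * Real.exp B * Real.exp (n * x + B * x - a * x * Real.log (x + 1)) := by
          rw [Complex.norm_real, Real.norm_of_nonneg hx0, show B * (x + 1) = B + B * x by ring,
            Real.exp_add, sub_eq_add_neg, Real.exp_add, Real.exp_add]
          ring
      _ ≤ _ := by
          gcongr
          nlinarith
  · refine ⟨2 * A', fun y => ?_⟩
    have h1 : ((y : ℂ) * Complex.I + 1 / 2).re = 1 / 2 := by simp
    have h2 : ((y : ℂ) * Complex.I + 1 / 2).im = y := by simp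
    have h3 := exp_le_norm_sin_of_re_eq_half h1
    rw [h2] at h3
    have h4 := hF' y
    rw [add_comm] at h4
    have hA' : 0 ≤ A' := by
      have := (norm_nonneg _).trans h4
      exact nonneg_of_mul_nonneg_left this (Real.exp_pos _)
    have h5 : (-(a : ℂ) * (y * Complex.I) * Complex.log (y * Complex.I + 1)).re =
        a * (y * Complex.arg (y * Complex.I + 1)) := by
      rw [show -(a : ℂ) * (y * Complex.I) = ((-(a * y) : ℝ) : ℂ) * Complex.I by push_cast; ring,
        mul_assoc, Complex.re_ofReal_mul, Complex.mul_re, Complex.log_im]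
      simp
      ring
    have h6 : y * Complex.arg (y * Complex.I + 1) ≤ |y| * (π / 2) := by
      refine (le_abs_self _).trans ?_
      rw [abs_mul]
      gcongr
      rw [Complex.abs_arg_le_pi_div_two_iff]
      simp
    rw [hψ, norm_mul, Complex.norm_exp, h5, hφ2 _ (hbd _ h1), norm_div]
    have h7 : a * (π / 2) = π - c := by rw [ha]; field_simp
    calc _ ≤ A' * Real.exp (c * |y|) / (Real.exp (π * |y|) / 2) * Real.exp (a * (|y| * (π / 2))) := by
          gcongr
      _ = 2 * A' * (Real.exp (c * |y|) * Real.exp (a * (|y| * (π / 2))) / Real.exp (π * |y|)) := by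
          field_simp
      _ = 2 * A' := by
          rw [← Real.exp_add, ← Real.exp_sub, show c * |y| + a * (|y| * (π / 2)) - π * |y| =
            (c + a * (π / 2) - π) * |y| by ring, h7]
          simp

/-! ### The moment problem under the Hausdorff condition. -/

/-- Riesz representation for a moment functional dominated by the norm of the corresponding
combinations of vectors. -/
theorem exists_inner_eq_of_norm_linearCombination_le {H : Type*} [NormedAddCommGroup H]
    [InnerProductSpace ℂ H] [CompleteSpace H] (e : ℕ → H) (f : ℕ → ℂ) (C : ℝ)
    (h : ∀ a : ℕ →₀ ℂ, ‖Finsupp.linearCombination ℂ f a‖ ≤ C * ‖Finsupp.linearCombination ℂ e a‖) :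
    ∃ w : H, ∀ k, inner ℂ w (e k) = f k := by
  set L := Finsupp.linearCombination ℂ f
  set T := Finsupp.linearCombination ℂ e
  -- The norm bound lets the functional factor through the span of the vectors; Hahn–Banach then
  -- extends it to all of H.
  obtain ⟨g, hg, -⟩ := exists_extension_norm_eq (LinearMap.range T) (L.compLeftInverse T)
  refine ⟨(InnerProductSpace.toDual ℂ H).symm g, fun k => ?_⟩
  rw [InnerProductSpace.toDual_symm_apply]
  have h1 := hg ⟨T (Finsupp.single k 1), LinearMap.mem_range_self _ _⟩
  have h2 := LinearMap.compLeftInverse_apply_of_bdd (f := L) (g := T) ⟨C, h⟩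
    (Finsupp.single k 1) _ rfl
  rw [h2] at h1
  simpa [L, T] using h1

open Polynomial in
theorem linearMap_X_pow_mul_one_sub_X_pow {f : ℕ → ℂ} {L : ℂ[X] →ₗ[ℂ] ℂ}
    (hL : ∀ k, L (X ^ k) = f k) (j k : ℕ) :
    L (X ^ k * (1 - X) ^ j) = (-1) ^ j * (fwdDiff 1)^[j] f k := by
  induction j generalizing k with
  | zero => simp [hL]
  | succ j ih =>
    have : (X : ℂ[X]) ^ k * (1 - X) ^ (j + 1) = X ^ k * (1 - X) ^ j - X ^ (k + 1) * (1 - X) ^ j := by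
      ring
    rw [this, map_sub, ih, ih, Function.iterate_succ_apply', fwdDiff]
    ring

-- The product C(k,m) C(n,k) equals C(n,m) C(n-m,k-m); pulling out C(n,m) X^m leaves the binomial
-- expansion of (X + (1 - X))^{n-m} = 1.
open Polynomial in
theorem sum_choose_mul_bernstein {n m : ℕ} (hm : m ≤ n) :
    ∑ k ∈ Finset.range (n + 1), ((k.choose m : ℂ) * n.choose k) • ((X : ℂ[X]) ^ k * (1 - X) ^ (n - k)) =
      (n.choose m : ℂ) • X ^ m := by
  obtain ⟨N, rfl⟩ := Nat.exists_eq_add_of_le hm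
  rw [show m + N + 1 = m + (N + 1) by ring, Finset.sum_range_add]
  rw [Finset.sum_eq_zero (s := Finset.range m), zero_add]
  · have h1 : ((X : ℂ[X]) + (1 - X)) ^ N = 1 := by simp
    rw [add_pow] at h1
    calc _ = ∑ i ∈ Finset.range (N + 1), ((m + N).choose m : ℂ) •
          ((X : ℂ[X]) ^ m * (X ^ i * (1 - X) ^ (N - i) * (N.choose i : ℂ[X]))) := by
          refine Finset.sum_congr rfl fun i hi => ?_
          have hi : i ≤ N := Nat.lt_succ_iff.1 (Finset.mem_range.1 hi)
          have h2 := Nat.choose_mul (n := m + N) (k := m + i) (s := m) (by omega)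
          rw [show m + N - m = N by omega, show m + i - m = i by omega] at h2
          have h3 : ((m + i).choose m : ℂ) * ((m + N).choose (m + i) : ℂ) =
              ((m + N).choose m : ℂ) * (N.choose i : ℂ) := by
            rw [mul_comm]; exact_mod_cast h2
          rw [h3, show m + N - (m + i) = N - i by omega, mul_smul, pow_add]
          congr 1
          rw [← C_mul', map_natCast]
          ring
      _ = _ := by
          rw [← Finset.smul_sum, ← Finset.mul_sum, h1, mul_one]
  · intro i hi
    simp [Nat.choose_eq_zero_of_lt (Finset.mem_range.1 hi)]

open Polynomial in
/-- The moments are recovered from the Bernstein weights. -/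
theorem sum_choose_mul_bernsteinWeight (f : ℕ → ℂ) {n m : ℕ} (hm : m ≤ n) :
    ∑ k ∈ Finset.range (n + 1), (k.choose m : ℂ) * bernsteinWeight f n k = n.choose m * f m := by
  set L : ℂ[X] →ₗ[ℂ] ℂ := (Polynomial.basisMonomials ℂ).constr ℂ f
  have hL : ∀ k, L (X ^ k) = f k := fun k => by
    have := (Polynomial.basisMonomials ℂ).constr_basis ℂ f k
    rw [Polynomial.coe_basisMonomials] at this
    rw [← Polynomial.monomial_one_right_eq_X_pow]
    exact this
  have h1 := congrArg L (sum_choose_mul_bernstein hm)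
  rw [map_sum, map_smul, hL, smul_eq_mul] at h1
  rw [← h1]
  refine Finset.sum_congr rfl fun k _ => ?_
  rw [map_smul, linearMap_X_pow_mul_one_sub_X_pow hL, bernsteinWeight, smul_eq_mul]
  ring

theorem choose_ratio_mem_Icc {n k : ℕ} (hk : k ≤ n) (i : ℕ) :
    0 ≤ (k.choose i : ℝ) / n.choose i ∧ (k.choose i : ℝ) / n.choose i ≤ 1 := by
  refine ⟨by positivity, div_le_one_of_le₀ ?_ (by positivity)⟩
  exact_mod_cast Nat.choose_le_choose i hk

/-- `C(k,i)/C(n,i)` is uniformly close to `(k/(n+1))^i`. -/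
theorem exists_choose_ratio_sub_pow_le (i : ℕ) : ∃ ε : ℕ → ℝ, Tendsto ε atTop (𝓝 0) ∧
    ∀ n, i ≤ n → ∀ k ≤ n, |(k.choose i : ℝ) / n.choose i - ((k : ℝ) / (n + 1)) ^ i| ≤ ε n := by
  induction i with
  | zero => exact ⟨0, tendsto_const_nhds, fun n _ k _ => by simp⟩
  | succ i ih =>
    obtain ⟨ε, hε, h⟩ := ih
    -- Passing from i to i + 1 multiplies the ratio by (k - i)/(n - i), which differs from k/(n + 1)
    -- by at most (i + 1)/(n - i). For n ≤ i the value of the error is irrelevant.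
    refine ⟨fun n => (i + 1) / ((n : ℝ) - i) + ε n, ?_, ?_⟩
    · have : Tendsto (fun n : ℕ => ((i : ℝ) + 1) / ((n : ℝ) - i)) atTop (𝓝 0) := by
        refine Tendsto.div_atTop tendsto_const_nhds ?_
        exact tendsto_atTop_add_const_right _ (-(i : ℝ)) tendsto_natCast_atTop_atTop
      simpa using this.add hε
    · intro n hn k hk
      have hin : (i : ℝ) + 1 ≤ n := by exact_mod_cast hn
      have hni : (0 : ℝ) < n - i := by linarith
      have hkn : (k : ℝ) ≤ n := by exact_mod_cast hk
      have hk0 : (0 : ℝ) ≤ k := by positivity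
      have hn1 : (0 : ℝ) < n + 1 := by positivity
      have hrec : ∀ m : ℕ, (m.choose (i + 1) : ℝ) = m.choose i * (m - i) / (i + 1) := by
        intro m
        rw [eq_div_iff (by positivity)]
        rcases le_or_gt i m with him | him
        · have := Nat.choose_succ_right_eq m i
          have h2 : ((m - i : ℕ) : ℝ) = m - i := Nat.cast_sub him
          rw [← h2]; exact_mod_cast this
        · simp [Nat.choose_eq_zero_of_lt him, Nat.choose_eq_zero_of_lt (Nat.lt_succ_of_lt him)]
      have hc0 : (n.choose i : ℝ) ≠ 0 :=
        Nat.cast_ne_zero.2 (Nat.choose_pos (by omega)).ne'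
      set r := (k.choose i : ℝ) / n.choose i with hr
      set t := (k : ℝ) / (n + 1) with ht
      have hrs : (k.choose (i + 1) : ℝ) / n.choose (i + 1) = r * ((k - i) / (n - i)) := by
        rw [hrec, hrec, hr]; field_simp
      obtain ⟨hr0, hr1⟩ := choose_ratio_mem_Icc hk i
      have ht0 : 0 ≤ t := by positivity
      have ht1 : t ≤ 1 := div_le_one_of_le₀ (by linarith) hn1.le
      have hst : |((k : ℝ) - i) / (n - i) - t| ≤ (i + 1) / ((n : ℝ) - i) := by
        rw [ht, div_sub_div _ _ hni.ne' hn1.ne', abs_div, abs_of_pos (mul_pos hni hn1),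
          div_le_div_iff₀ (mul_pos hni hn1) hni]
        have : |((k : ℝ) - i) * (n + 1) - (n - i) * k| ≤ (i + 1) * (n + 1) := by
          rw [abs_le]
          have hi0 : (0 : ℝ) ≤ i := by positivity
          constructor <;> nlinarith
        nlinarith
      have h1 := h n (by omega) k hk
      rw [hrs, pow_succ]
      calc |r * ((k - i) / (n - i)) - t ^ i * t|
          = |r * (((k : ℝ) - i) / (n - i) - t) + t * (r - t ^ i)| := by congr 1; ring
        _ ≤ |r * (((k : ℝ) - i) / (n - i) - t)| + |t * (r - t ^ i)| := abs_add_le _ _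
        _ ≤ 1 * |((k : ℝ) - i) / (n - i) - t| + 1 * |r - t ^ i| := by
          rw [abs_mul, abs_mul, abs_of_nonneg hr0, abs_of_nonneg ht0]
          gcongr
        _ ≤ _ := by linarith

/-- Riemann sums of `x^m` on `[0,1]`. -/
theorem tendsto_average_pow (m : ℕ) :
    Tendsto (fun n : ℕ => 1 / ((n : ℝ) + 1) * ∑ k ∈ Finset.range (n + 1), ((k : ℝ) / (n + 1)) ^ m)
      atTop (𝓝 (1 / (m + 1))) := by
  -- The increment of x^{m+1} over [k, k+1] is a sum of m + 1 products lying between k^m and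
  -- (k+1)^m; telescoping then squeezes the power sum.
  have hlow : ∀ k : ℕ, ((m : ℝ) + 1) * (k : ℝ) ^ m ≤ ((k : ℝ) + 1) ^ (m + 1) - (k : ℝ) ^ (m + 1) ∧
      ((k : ℝ) + 1) ^ (m + 1) - (k : ℝ) ^ (m + 1) ≤ ((m : ℝ) + 1) * ((k : ℝ) + 1) ^ m := by
    intro k
    have hg := (Commute.all ((k : ℝ) + 1) (k : ℝ)).geom_sum₂_mul (m + 1)
    rw [add_sub_cancel_left, mul_one] at hg
    rw [← hg]
    have hcard : ((m : ℝ) + 1) = ((Finset.range (m + 1)).card : ℝ) := by simp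
    rw [hcard, ← nsmul_eq_mul, ← nsmul_eq_mul]
    have hle : (k : ℝ) ≤ k + 1 := by linarith
    constructor
    · refine Finset.card_nsmul_le_sum _ _ _ fun i hi => ?_
      have hi : i ≤ m := Nat.lt_succ_iff.1 (Finset.mem_range.1 hi)
      calc (k : ℝ) ^ m = (k : ℝ) ^ i * (k : ℝ) ^ (m - i) := by rw [← pow_add]; congr 1; omega
        _ ≤ _ := by
          rw [show m + 1 - 1 - i = m - i by omega]; gcongr
    · refine Finset.sum_le_card_nsmul _ _ _ fun i hi => ?_
      have hi : i ≤ m := Nat.lt_succ_iff.1 (Finset.mem_range.1 hi)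
      calc _ ≤ ((k : ℝ) + 1) ^ i * ((k : ℝ) + 1) ^ (m - i) := by
            rw [show m + 1 - 1 - i = m - i by omega]; gcongr
        _ = _ := by rw [← pow_add]; congr 1; omega
  set S : ℕ → ℝ := fun n => ∑ k ∈ Finset.range (n + 1), (k : ℝ) ^ m with hS
  have htel : ∀ n : ℕ, ∑ k ∈ Finset.range (n + 1), (((k : ℝ) + 1) ^ (m + 1) - (k : ℝ) ^ (m + 1)) =
      ((n : ℝ) + 1) ^ (m + 1) := by
    intro n
    have := Finset.sum_range_sub (fun k : ℕ => (k : ℝ) ^ (m + 1)) (n + 1)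
    push_cast at this
    rw [this]; simp
  have hup : ∀ n : ℕ, ((m : ℝ) + 1) * S n ≤ ((n : ℝ) + 1) ^ (m + 1) := by
    intro n
    rw [← htel, hS, Finset.mul_sum]
    exact Finset.sum_le_sum fun k _ => (hlow k).1
  have hdn : ∀ n : ℕ, ((n : ℝ) + 1) ^ (m + 1) ≤ ((m : ℝ) + 1) * (S n + ((n : ℝ) + 1) ^ m) := by
    intro n
    have h1 : ∑ k ∈ Finset.range (n + 1), ((k : ℝ) + 1) ^ m ≤ S n + ((n : ℝ) + 1) ^ m := by
      have h2 : S n + ((n : ℝ) + 1) ^ m = ∑ k ∈ Finset.range (n + 1 + 1), (k : ℝ) ^ m := by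
        rw [Finset.sum_range_succ]; push_cast; rfl
      rw [h2, Finset.sum_range_succ' _ (n + 1)]
      push_cast
      have : (0 : ℝ) ≤ 0 ^ m := by positivity
      linarith
    calc _ ≤ ((m : ℝ) + 1) * ∑ k ∈ Finset.range (n + 1), ((k : ℝ) + 1) ^ m := by
          rw [← htel, Finset.mul_sum]
          exact Finset.sum_le_sum fun k _ => (hlow k).2
      _ ≤ _ := by gcongr
  have heq : ∀ n : ℕ, 1 / ((n : ℝ) + 1) * ∑ k ∈ Finset.range (n + 1), ((k : ℝ) / (n + 1)) ^ m =
      S n / ((n : ℝ) + 1) ^ (m + 1) := by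
    intro n
    simp only [hS, div_pow, ← Finset.sum_div]
    rw [div_mul_div_comm, one_mul, ← pow_succ']
  simp only [heq]
  have hlim : Tendsto (fun n : ℕ => (1 : ℝ) / (m + 1) - 1 / ((n : ℝ) + 1)) atTop
      (𝓝 (1 / (m + 1))) := by
    simpa using tendsto_const_nhds.sub (tendsto_one_div_add_atTop_nhds_zero_nat (𝕜 := ℝ))
  refine tendsto_of_tendsto_of_tendsto_of_le_of_le hlim tendsto_const_nhds (fun n => ?_) fun n => ?_
  · have h1 := hdn n
    have hn : (0 : ℝ) < (n : ℝ) + 1 := by positivity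
    simp only
    rw [le_div_iff₀ (by positivity), sub_mul, div_mul_eq_mul_div, one_mul, div_mul_eq_mul_div,
      one_mul, pow_succ' ((n : ℝ) + 1), mul_div_cancel_left₀ _ hn.ne', sub_le_iff_le_add,
      div_le_iff₀ (by positivity), ← pow_succ']
    linarith
  · simp only
    rw [div_le_div_iff₀ (by positivity) (by positivity)]
    have := hup n
    linarith

/-- Up to a uniformly vanishing error the product is (k/(n+1))^{i+j}, so the average is a Riemann
sum of x^{i+j}. The limits are the entries of the Hilbert matrix, the Gram matrix of the monomials
in L²(0,1). -/
theorem tendsto_average_choose_ratio_mul (i j : ℕ) :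
    Tendsto (fun n : ℕ => 1 / ((n : ℝ) + 1) * ∑ k ∈ Finset.range (n + 1),
      ((k.choose i : ℝ) / n.choose i) * ((k.choose j : ℝ) / n.choose j))
      atTop (𝓝 (1 / (i + j + 1))) := by
  obtain ⟨ε, hε, hi⟩ := exists_choose_ratio_sub_pow_le i
  obtain ⟨δ, hδ, hj⟩ := exists_choose_ratio_sub_pow_le j
  have h0 := tendsto_average_pow (i + j)
  rw [Nat.cast_add] at h0
  refine h0.congr_dist ?_
  have hεδ : Tendsto (fun n => ε n + δ n) atTop (𝓝 0) := by simpa using hε.add hδ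
  refine squeeze_zero' (Eventually.of_forall fun _ => dist_nonneg) ?_ hεδ
  filter_upwards [eventually_ge_atTop i, eventually_ge_atTop j] with n hni hnj
  have hn1 : (0 : ℝ) < n + 1 := by positivity
  rw [Real.dist_eq, ← mul_sub, ← Finset.sum_sub_distrib, abs_mul, abs_of_pos (by positivity),
    one_div, inv_mul_le_iff₀ hn1]
  have hcard : ((n : ℝ) + 1) * (ε n + δ n) = ∑ k ∈ Finset.range (n + 1), (ε n + δ n) := by
    rw [Finset.sum_const, Finset.card_range, nsmul_eq_mul]; push_cast; rfl
  rw [hcard]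
  refine (Finset.abs_sum_le_sum_abs _ _).trans (Finset.sum_le_sum fun k hk => ?_)
  have hk : k ≤ n := Nat.lt_succ_iff.1 (Finset.mem_range.1 hk)
  obtain ⟨hr0, hr1⟩ := choose_ratio_mem_Icc hk i
  have h1 := hi n hni k hk
  have h2 := hj n hnj k hk
  set r := (k.choose i : ℝ) / n.choose i
  set s := (k.choose j : ℝ) / n.choose j
  set t := (k : ℝ) / (n + 1) with ht
  have ht0 : 0 ≤ t := by positivity
  have ht1 : t ≤ 1 := div_le_one_of_le₀ (by have : (k : ℝ) ≤ n := by exact_mod_cast hk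
                                            linarith) hn1.le
  calc |t ^ (i + j) - r * s| = |t ^ j * (t ^ i - r) + r * (t ^ j - s)| := by
        congr 1; rw [pow_add]; ring
    _ ≤ |t ^ j * (t ^ i - r)| + |r * (t ^ j - s)| := abs_add_le _ _
    _ ≤ 1 * |t ^ i - r| + 1 * |t ^ j - s| := by
        rw [abs_mul, abs_mul, abs_of_nonneg hr0, abs_of_nonneg (pow_nonneg ht0 j)]
        gcongr
        exact pow_le_one₀ ht0 ht1
    _ ≤ _ := by rw [abs_sub_comm, abs_sub_comm (t ^ j)]; linarith

/-- Each f_m is the sum over k of C(k,m)/C(n,m) times the k-th weight. Hence the functional is a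
pairing of the weights with a discretised polynomial, and Cauchy–Schwarz applies. -/
theorem norm_sq_moment_le {f : ℕ → ℂ} {M : ℝ} {n : ℕ}
    (hM : ((n : ℝ) + 1) * ∑ k ∈ Finset.range (n + 1), ‖bernsteinWeight f n k‖ ^ 2 ≤ M)
    (a : ℕ →₀ ℂ) (hn : ∀ m ∈ a.support, m ≤ n) :
    ‖Finsupp.linearCombination ℂ f a‖ ^ 2 ≤ M * (1 / ((n : ℝ) + 1) * ∑ k ∈ Finset.range (n + 1),
      ‖∑ m ∈ a.support, a m * (((k.choose m : ℝ) / n.choose m : ℝ) : ℂ)‖ ^ 2) := by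
  set Q : ℕ → ℂ := fun k => ∑ m ∈ a.support, a m * (((k.choose m : ℝ) / n.choose m : ℝ) : ℂ) with hQ
  have h1 : Finsupp.linearCombination ℂ f a =
      ∑ k ∈ Finset.range (n + 1), bernsteinWeight f n k * Q k := by
    simp only [hQ, Finset.mul_sum]
    rw [Finset.sum_comm, Finsupp.linearCombination_apply, Finsupp.sum]
    refine Finset.sum_congr rfl fun m hm => ?_
    have hc : (n.choose m : ℂ) ≠ 0 := Nat.cast_ne_zero.2 (Nat.choose_pos (hn m hm)).ne'
    have h2 := sum_choose_mul_bernsteinWeight f (hn m hm)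
    have h3 : f m = (∑ k ∈ Finset.range (n + 1), (k.choose m : ℂ) * bernsteinWeight f n k) /
        n.choose m := by rw [h2, mul_div_cancel_left₀ _ hc]
    rw [h3, smul_eq_mul, Finset.sum_div, Finset.mul_sum]
    refine Finset.sum_congr rfl fun k _ => ?_
    push_cast
    ring
  have hn1 : (0 : ℝ) < n + 1 := by positivity
  have h2 : ‖Finsupp.linearCombination ℂ f a‖ ^ 2 ≤
      (∑ k ∈ Finset.range (n + 1), ‖bernsteinWeight f n k‖ ^ 2) *
        ∑ k ∈ Finset.range (n + 1), ‖Q k‖ ^ 2 := by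
    refine le_trans ?_ (Finset.sum_mul_sq_le_sq_mul_sq _ _ _)
    rw [h1]
    gcongr
    exact (norm_sum_le _ _).trans (by simp)
  refine h2.trans ?_
  have h3 : ∑ k ∈ Finset.range (n + 1), ‖bernsteinWeight f n k‖ ^ 2 ≤ M * (1 / ((n : ℝ) + 1)) := by
    rw [mul_one_div, le_div_iff₀ hn1]; linarith
  rw [← mul_assoc]
  gcongr

/-- A sequence satisfying the Hausdorff condition with exponent `2` is dominated, as a moment
functional, by any system with Gram matrix `1/(i+j+1)`. -/
theorem norm_moment_le_of_gram {H : Type*} [NormedAddCommGroup H] [InnerProductSpace ℂ H]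
    {e : ℕ → H} (he : ∀ i j : ℕ, inner ℂ (e i) (e j) = ((1 / ((i : ℝ) + j + 1) : ℝ) : ℂ))
    {f : ℕ → ℂ} {M : ℝ}
    (hM : ∀ n : ℕ, ((n : ℝ) + 1) * ∑ k ∈ Finset.range (n + 1), ‖bernsteinWeight f n k‖ ^ 2 ≤ M)
    (a : ℕ →₀ ℂ) :
    ‖Finsupp.linearCombination ℂ f a‖ ≤ √M * ‖Finsupp.linearCombination ℂ e a‖ := by
  have hM0 : 0 ≤ M := le_trans (by positivity) (hM 0)
  set c : ℕ → ℝ := fun n => 1 / ((n : ℝ) + 1) * ∑ k ∈ Finset.range (n + 1),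
    ‖∑ m ∈ a.support, a m * (((k.choose m : ℝ) / n.choose m : ℝ) : ℂ)‖ ^ 2 with hc
  -- Both the discrete mean square and the norm are Hermitian forms in the coefficients, so the
  -- limit is taken entry by entry in their matrices.
  have hlim : Tendsto (fun n => (c n : ℂ)) atTop
      (𝓝 ((‖Finsupp.linearCombination ℂ e a‖ ^ 2 : ℝ) : ℂ)) := by
    have h1 : ((‖Finsupp.linearCombination ℂ e a‖ ^ 2 : ℝ) : ℂ) =
        ∑ i ∈ a.support, ∑ j ∈ a.support, (starRingEnd ℂ) (a i) * a j *
          ((1 / ((i : ℝ) + j + 1) : ℝ) : ℂ) := by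
      have := inner_self_eq_norm_sq_to_K (𝕜 := ℂ) (Finsupp.linearCombination ℂ e a)
      push_cast
      refine this.symm.trans ?_
      rw [Finsupp.linearCombination_apply, Finsupp.sum, sum_inner]
      refine Finset.sum_congr rfl fun i _ => ?_
      rw [inner_sum]
      refine Finset.sum_congr rfl fun j _ => ?_
      rw [inner_smul_left, inner_smul_right, he]
      push_cast
      ring
    have h2 : ∀ n, (c n : ℂ) = ∑ i ∈ a.support, ∑ j ∈ a.support, (starRingEnd ℂ) (a i) * a j *
        ((1 / ((n : ℝ) + 1) * ∑ k ∈ Finset.range (n + 1),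
          ((k.choose i : ℝ) / n.choose i) * ((k.choose j : ℝ) / n.choose j) : ℝ) : ℂ) := by
      intro n
      have h3 : ∀ z : ℂ, ((‖z‖ ^ 2 : ℝ) : ℂ) = (starRingEnd ℂ) z * z := fun z => by
        rw [← Complex.normSq_eq_norm_sq, Complex.normSq_eq_conj_mul_self]
      rw [hc, Complex.ofReal_mul, Complex.ofReal_sum]
      simp only [h3, map_sum, map_mul, Complex.conj_ofReal, Finset.sum_mul_sum]
      rw [Finset.sum_comm, Finset.mul_sum]
      refine Finset.sum_congr rfl fun i _ => ?_
      rw [Finset.sum_comm, Finset.mul_sum]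
      refine Finset.sum_congr rfl fun j _ => ?_
      rw [Complex.ofReal_mul, Complex.ofReal_sum, Finset.mul_sum, Finset.mul_sum, Finset.mul_sum]
      refine Finset.sum_congr rfl fun k _ => ?_
      push_cast
      ring
    simp only [h1, h2]
    refine tendsto_finsetSum _ fun i _ => tendsto_finsetSum _ fun j _ => ?_
    exact ((Complex.continuous_ofReal.tendsto _).comp
      (tendsto_average_choose_ratio_mul i j)).const_mul _
  have hlim' : Tendsto c atTop (𝓝 (‖Finsupp.linearCombination ℂ e a‖ ^ 2)) := by
    exact (Complex.continuous_re.tendsto _).comp hlim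
  have hle : ‖Finsupp.linearCombination ℂ f a‖ ^ 2 ≤
      M * ‖Finsupp.linearCombination ℂ e a‖ ^ 2 := by
    refine ge_of_tendsto (hlim'.const_mul M) ?_
    filter_upwards [eventually_ge_atTop (a.support.sup id)] with n hn
    exact norm_sq_moment_le (hM n) a fun m hm => (Finset.le_sup (f := id) hm).trans hn
  refine abs_le_of_sq_le_sq' ?_ (by positivity) |>.2
  rwa [mul_pow, Real.sq_sqrt hM0]

theorem integral_cexp_neg_mul_Ioi {z : ℂ} (hz : 0 < z.re) :
    ∫ v in Ioi (0 : ℝ), Complex.exp (-z * v) = 1 / z := by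
  have := integral_exp_mul_complex_Ioi (a := -z) (by simpa using hz) 0
  rw [this]
  simp

theorem memLp_two_exp {b : ℝ} (hb : 0 < b) :
    MemLp (fun v : ℝ => (Real.exp (-b * v) : ℂ)) 2 (volume.restrict (Ioi 0)) := by
  rw [memLp_two_iff_integrable_sq_norm (by fun_prop)]
  have := exp_neg_integrableOn_Ioi 0 (show 0 < 2 * b by linarith)
  refine this.congr (Eventually.of_forall fun v => ?_)
  simp only [Complex.norm_real, Real.norm_eq_abs, Real.abs_exp]
  rw [← Real.exp_nat_mul]
  congr 1
  push_cast
  ring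

/-- A sequence satisfying the Hausdorff condition with exponent `2` is the sequence of values at
the natural numbers of the Laplace transform of a function in `L¹ ∩ L²`. -/
theorem HausdorffCondition.exists_laplace {f : ℕ → ℂ} (hf : HausdorffCondition 2 f) :
    ∃ u : ℝ → ℂ, (∀ v ≤ 0, u v = 0) ∧ Integrable u ∧ MemLp u 2 ∧
      ∀ k : ℕ, ∫ v, u v * Complex.exp (-(k : ℂ) * v) = f k := by
  obtain ⟨M, -, hM⟩ := hf
  have hM' : ∀ n : ℕ, ((n : ℝ) + 1) *
      ∑ k ∈ Finset.range (n + 1), ‖bernsteinWeight f n k‖ ^ 2 ≤ M := fun n => by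
    have := (hM n).le
    norm_num at this
    exact this
  have hb : ∀ i : ℕ, (0 : ℝ) < i + 1 / 2 := fun i => by positivity
  -- The shift by 1/2 is the square root of the Jacobian of x = e^{-v}: these are the monomials x^i
  -- of L²(0,1) carried isometrically to L²(0,∞).
  set e : ℕ → Lp ℂ 2 (volume.restrict (Ioi (0 : ℝ))) := fun i => (memLp_two_exp (hb i)).toLp
  have heae : ∀ i, e i =ᵐ[volume.restrict (Ioi (0 : ℝ))]
    fun v : ℝ => (Real.exp (-((i : ℝ) + 1 / 2) * v) : ℂ) := fun i => MemLp.coeFn_toLp _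
  have he : ∀ i j : ℕ, inner ℂ (e i) (e j) = ((1 / ((i : ℝ) + j + 1) : ℝ) : ℂ) := by
    intro i j
    rw [L2.inner_def]
    have h1 := integral_cexp_neg_mul_Ioi (z := (i : ℂ) + j + 1) (by simp; positivity)
    push_cast
    rw [← h1]
    refine integral_congr_ae ?_
    filter_upwards [heae i, heae j] with v h1 h2
    rw [h1, h2, RCLike.inner_apply, Complex.conj_ofReal, ← Complex.ofReal_mul, ← Real.exp_add,
      Complex.ofReal_exp]
    congr 1
    push_cast
    ring
  obtain ⟨w, hw⟩ := exists_inner_eq_of_norm_linearCombination_le e f (√M)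
    (norm_moment_le_of_gram he hM')
  have hw2 : MemLp (fun v => (starRingEnd ℂ) (w v)) 2 (volume.restrict (Ioi (0 : ℝ))) :=
    (Lp.memLp w).star
  have hb' : (0 : ℝ) < 1 / 2 := by norm_num
  -- The factor e^{-v/2} is split off from every e_k and given to u; as a product of two L²
  -- functions u becomes integrable. The conjugate is there because the inner product is
  -- conjugate-linear in its first slot.
  set u₀ : ℝ → ℂ := fun v => (starRingEnd ℂ) (w v) * (Real.exp (-(1 / 2) * v) : ℂ)
  refine ⟨(Ioi (0 : ℝ)).indicator u₀, fun v hv => by simp [hv], ?_, ?_, fun k => ?_⟩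
  · rw [integrable_indicator_iff measurableSet_Ioi]
    exact hw2.integrable_mul (memLp_two_exp hb')
  · rw [memLp_indicator_iff_restrict measurableSet_Ioi]
    refine MemLp.of_le hw2 (hw2.1.mul (memLp_two_exp hb').1) ?_
    filter_upwards [ae_restrict_mem measurableSet_Ioi] with v hv
    rw [norm_mul, Complex.norm_real, Real.norm_eq_abs, Real.abs_exp]
    refine mul_le_of_le_one_right (norm_nonneg _) (Real.exp_le_one_iff.2 ?_)
    have hv : 0 < v := hv
    linarith
  · rw [← hw k, L2.inner_def]
    have : ∀ v : ℝ, (Ioi (0 : ℝ)).indicator u₀ v * Complex.exp (-(k : ℂ) * v) =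
        (Ioi (0 : ℝ)).indicator (fun v => u₀ v * Complex.exp (-(k : ℂ) * v)) v := fun v => by
      by_cases hv : v ∈ Ioi (0 : ℝ) <;> simp [hv]
    simp only [this]
    rw [integral_indicator measurableSet_Ioi]
    refine integral_congr_ae ?_
    filter_upwards [heae k] with v hv
    rw [hv, RCLike.inner_apply]
    simp only [u₀]
    rw [mul_assoc, Complex.ofReal_exp, Complex.ofReal_exp, ← Complex.exp_add, mul_comm]
    congr 2
    push_cast
    ring

/-! ### The primitive of u and its Laplace transform. -/

section LaplacePrimitive

/-- The primitive of `u` vanishing at `0`. -/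
noncomputable def primitiveFromZero (u : ℝ → ℂ) (v : ℝ) : ℂ := ∫ s in (0 : ℝ)..v, u s

theorem primitiveFromZero_of_nonpos {u : ℝ → ℂ} (hu0 : ∀ v ≤ 0, u v = 0) {v : ℝ} (hv : v ≤ 0) :
    primitiveFromZero u v = 0 := by
  refine intervalIntegral.integral_zero_ae (Eventually.of_forall fun s hs => hu0 s ?_)
  rw [uIoc_of_ge hv] at hs
  exact hs.2

theorem continuous_primitiveFromZero {u : ℝ → ℂ} (hu : Integrable u) :
    Continuous (primitiveFromZero u) :=
  intervalIntegral.continuous_primitive (fun _ _ => hu.intervalIntegrable) 0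

theorem norm_primitiveFromZero_le {u : ℝ → ℂ} (hu : Integrable u) (v : ℝ) :
    ‖primitiveFromZero u v‖ ≤ ∫ s, ‖u s‖ :=
  intervalIntegral.norm_integral_le_integral_norm_uIoc.trans
    (setIntegral_le_integral hu.norm (Eventually.of_forall fun _ => norm_nonneg _))

theorem norm_cexp_neg_mul_ofReal (z : ℂ) (v : ℝ) :
    ‖Complex.exp (-z * v)‖ = Real.exp (-z.re * v) := by
  rw [Complex.norm_exp]
  simp

theorem integrableOn_primitiveFromZero_mul_cexp {u : ℝ → ℂ} (hu : Integrable u) {z : ℂ}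
    (hz : 0 < z.re) :
    IntegrableOn (fun v : ℝ => primitiveFromZero u v * Complex.exp (-z * v)) (Ioi 0) := by
  have h1 := (exp_neg_integrableOn_Ioi 0 hz).const_mul (∫ s, ‖u s‖)
  refine h1.mono' ?_ (Eventually.of_forall fun v => ?_)
  · have := continuous_primitiveFromZero hu
    exact Continuous.aestronglyMeasurable (by fun_prop)
  · rw [norm_mul, norm_cexp_neg_mul_ofReal]
    gcongr
    exact norm_primitiveFromZero_le hu v

theorem integrable_mul_cexp_neg {u : ℝ → ℂ} (hu0 : ∀ v ≤ 0, u v = 0) (hu : Integrable u) {z : ℂ}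
    (hz : 0 ≤ z.re) : Integrable (fun v : ℝ => u v * Complex.exp (-z * v)) ∧
      ∀ v : ℝ, ‖u v * Complex.exp (-z * v)‖ ≤ ‖u v‖ := by
  have hle : ∀ v : ℝ, ‖u v * Complex.exp (-z * v)‖ ≤ ‖u v‖ := by
    intro v
    rcases le_or_gt v 0 with hv | hv
    · simp [hu0 v hv]
    · rw [norm_mul, norm_cexp_neg_mul_ofReal]
      exact mul_le_of_le_one_right (norm_nonneg _) (Real.exp_le_one_iff.2 (by nlinarith))
  exact ⟨hu.norm.mono' (hu.1.mul (Continuous.aestronglyMeasurable (by fun_prop)))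
    (Eventually.of_forall hle), hle⟩

/-- The Laplace transform of a primitive. -/
theorem mul_laplaceTransform_primitiveFromZero {u : ℝ → ℂ} (hu0 : ∀ v ≤ 0, u v = 0)
    (hu : Integrable u) {z : ℂ} (hz : 0 < z.re) :
    z * laplaceTransform (primitiveFromZero u) z = ∫ v, u v * Complex.exp (-z * v) := by
  set μ := volume.restrict (Ioi (0 : ℝ)) with hμ
  -- Fubini on the triangle s < v: integrating over v first gives e^{-zs}/z, integrating over s
  -- first gives the primitive.
  set T : Set (ℝ × ℝ) := {p | p.1 < p.2} with hT
  have hTm : MeasurableSet T := measurableSet_lt measurable_fst measurable_snd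
  have hexp : Integrable (fun v : ℝ => Complex.exp (-z * v)) μ := by
    refine (exp_neg_integrableOn_Ioi 0 hz).mono' (Continuous.aestronglyMeasurable (by fun_prop))
      (Eventually.of_forall fun v => ?_)
    rw [norm_cexp_neg_mul_ofReal]
  have hprod : Integrable (T.indicator fun p : ℝ × ℝ => u p.1 * Complex.exp (-z * p.2))
      (μ.prod μ) :=
    (Integrable.mul_prod (hu.restrict (s := Ioi 0)) hexp).indicator hTm
  have hswap := integral_integral_swap (f := fun s v : ℝ =>
    T.indicator (fun p : ℝ × ℝ => u p.1 * Complex.exp (-z * p.2)) (s, v)) hprod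
  have hz0 : z ≠ 0 := fun h => by simp [h] at hz
  have hleft : ∫ s, ∫ v, T.indicator (fun p : ℝ × ℝ => u p.1 * Complex.exp (-z * p.2)) (s, v) ∂μ ∂μ =
      (∫ v, u v * Complex.exp (-z * v)) / z := by
    have h1 : ∫ v, u v * Complex.exp (-z * v) = ∫ v, u v * Complex.exp (-z * v) ∂μ := by
      rw [hμ, setIntegral_eq_integral_of_forall_compl_eq_zero]
      intro v hv
      rw [hu0 v (not_lt.1 hv), zero_mul]
    rw [h1, ← integral_div]
    refine integral_congr_ae ?_
    filter_upwards [ae_restrict_mem measurableSet_Ioi] with s hs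
    have h2 : ∀ v, T.indicator (fun p : ℝ × ℝ => u p.1 * Complex.exp (-z * p.2)) (s, v) =
        (Ioi s).indicator (fun v => u s * Complex.exp (-z * v)) v := fun v => by
      by_cases h : s < v <;> simp [hT, Set.indicator, h]
    simp only [h2]
    rw [integral_indicator measurableSet_Ioi, hμ, Measure.restrict_restrict measurableSet_Ioi,
      inter_eq_left.2 (Ioi_subset_Ioi (le_of_lt hs)), integral_const_mul,
      integral_exp_mul_complex_Ioi (by simpa using hz)]
    field_simp
  have hright : ∫ v, ∫ s, T.indicator (fun p : ℝ × ℝ => u p.1 * Complex.exp (-z * p.2)) (s, v) ∂μ ∂μ =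
      laplaceTransform (primitiveFromZero u) z := by
    refine integral_congr_ae ?_
    filter_upwards [ae_restrict_mem measurableSet_Ioi] with v hv
    have hv : 0 < v := hv
    have h2 : ∀ s, T.indicator (fun p : ℝ × ℝ => u p.1 * Complex.exp (-z * p.2)) (s, v) =
        (Iio v).indicator (fun s => u s * Complex.exp (-z * v)) s := fun s => by
      by_cases h : s < v <;> simp [hT, Set.indicator, h]
    simp only [h2]
    rw [integral_indicator measurableSet_Iio, hμ, Measure.restrict_restrict measurableSet_Iio,
      integral_mul_const, primitiveFromZero, intervalIntegral.integral_of_le hv.le,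
      integral_Ioc_eq_integral_Ioo, inter_comm, Ioi_inter_Iio]
  rw [hleft, hright] at hswap
  rw [← hswap, mul_div_cancel₀ _ hz0]

theorem differentiableAt_laplaceTransform {J : ℝ → ℂ} (hJ : Continuous J) {C : ℝ}
    (hC : ∀ v, ‖J v‖ ≤ C) {z : ℂ} (hz : 0 < z.re) : DifferentiableAt ℂ (laplaceTransform J) z := by
  have hC0 : 0 ≤ C := (norm_nonneg _).trans (hC 0)
  -- On the half-plane Re w > b, a neighbourhood of z, the differentiated integrand is dominated by
  -- C v e^{-bv}.
  set b := z.re / 2 with hb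
  have hb0 : 0 < b := by positivity
  have hint : IntegrableOn (fun v : ℝ => v * Real.exp (-b * v)) (Ioi 0) := by
    have := integrableOn_rpow_mul_exp_neg_mul_rpow (s := 1) (p := 1) (by norm_num) one_pos hb0
    simpa using this
  refine (hasDerivAt_integral_of_dominated_loc_of_deriv_le (μ := volume.restrict (Ioi (0 : ℝ)))
    (F := fun z v => J v * Complex.exp (-z * v)) (x₀ := z) (s := {w : ℂ | b < w.re})
    (F' := fun z v => J v * (Complex.exp (-z * v) * (-v)))
    (bound := fun v => C * (v * Real.exp (-b * v))) ?_ ?_ ?_ ?_ ?_ ?_ ?_).2.differentiableAt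
  · exact (isOpen_lt continuous_const Complex.continuous_re).mem_nhds
      (show b < z.re by rw [hb]; linarith)
  · exact Eventually.of_forall fun w => Continuous.aestronglyMeasurable (by fun_prop)
  · refine ((exp_neg_integrableOn_Ioi 0 hz).const_mul C).mono'
      (Continuous.aestronglyMeasurable (by fun_prop)) (Eventually.of_forall fun v => ?_)
    rw [norm_mul, norm_cexp_neg_mul_ofReal]
    gcongr
    exact hC v
  · exact Continuous.aestronglyMeasurable (by fun_prop)
  · filter_upwards [ae_restrict_mem measurableSet_Ioi] with v hv w hw
    have hv : 0 < v := hv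
    have hw : b < w.re := hw
    rw [norm_mul, norm_mul, norm_cexp_neg_mul_ofReal, norm_neg, Complex.norm_real,
      Real.norm_of_nonneg hv.le, mul_comm (Real.exp _)]
    gcongr
    exact hC v
  · exact hint.const_mul C
  · refine Eventually.of_forall fun v w _ => ?_
    refine HasDerivAt.const_mul _ ?_
    have h1 : HasDerivAt (fun w : ℂ => -w * v) (-v) w := by
      simpa using ((hasDerivAt_id w).neg.mul_const (v : ℂ))
    exact h1.cexp

end LaplacePrimitive

/-! ### Fourier analysis along vertical lines. -/

section LineFourier

open FourierTransform

theorem fourier_mul_exp_neg (J : ℝ → ℂ) (l ξ : ℝ) :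
    𝓕 (fun v : ℝ => J v * (Real.exp (-l * v) : ℂ)) ξ =
      ∫ v : ℝ, J v * Complex.exp (-((l : ℂ) + ((2 * π * ξ : ℝ) : ℂ) * Complex.I) * v) := by
  rw [Real.fourier_real_eq_integral_exp_smul]
  refine integral_congr_ae (Eventually.of_forall fun v => ?_)
  simp only [smul_eq_mul]
  rw [mul_left_comm, Complex.ofReal_exp, ← Complex.exp_add]
  congr 2
  push_cast
  ring

theorem fourier_eq_laplaceTransform {J : ℝ → ℂ} (hJ0 : ∀ v ≤ 0, J v = 0) (l ξ : ℝ) :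
    𝓕 (fun v : ℝ => J v * (Real.exp (-l * v) : ℂ)) ξ =
      laplaceTransform J ((l : ℂ) + ((2 * π * ξ : ℝ) : ℂ) * Complex.I) := by
  rw [fourier_mul_exp_neg, laplaceTransform, setIntegral_eq_integral_of_forall_compl_eq_zero]
  intro v hv
  rw [hJ0 v (not_lt.1 hv), zero_mul]

/-- The transform of u on the line is in L² by Plancherel, and so is 1/z. Their product is the
transform of the primitive, hence in L¹. -/
theorem integrable_laplaceTransform_line {u : ℝ → ℂ} (hu0 : ∀ v ≤ 0, u v = 0)
    (hu : Integrable u) (hu2 : MemLp u 2) {l : ℝ} (hl : 0 < l) :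
    Integrable fun ξ : ℝ => laplaceTransform (primitiveFromZero u)
      ((l : ℂ) + ((2 * π * ξ : ℝ) : ℂ) * Complex.I) := by
  set gt := laplaceTransform (primitiveFromZero u)
  have hexpform : ∀ v : ℝ, u v * (Real.exp (-l * v) : ℂ) = u v * Complex.exp (-(l : ℂ) * v) := by
    intro v; rw [Complex.ofReal_exp]; push_cast; rfl
  have hw := integrable_mul_cexp_neg hu0 hu (z := (l : ℂ)) (by simpa using hl.le)
  have hw1 : Integrable (fun v : ℝ => u v * (Real.exp (-l * v) : ℂ)) := by
    simpa only [hexpform] using hw.1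
  have hw2 : MemLp (fun v : ℝ => u v * (Real.exp (-l * v) : ℂ)) 2 := by
    refine MemLp.of_le hu2 hw1.1 (Eventually.of_forall fun v => ?_)
    rw [hexpform]; exact hw.2 v
  have hF2 := (memLp_two_fourier hw1 hw2).1
  have hre : ∀ ξ : ℝ, ((l : ℂ) + ((2 * π * ξ : ℝ) : ℂ) * Complex.I).re = l := fun ξ => by
    simp
  have hF : ∀ ξ : ℝ, 𝓕 (fun v : ℝ => u v * (Real.exp (-l * v) : ℂ)) ξ =
      ((l : ℂ) + ((2 * π * ξ : ℝ) : ℂ) * Complex.I) *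
        gt ((l : ℂ) + ((2 * π * ξ : ℝ) : ℂ) * Complex.I) := by
    intro ξ
    rw [fourier_mul_exp_neg, mul_laplaceTransform_primitiveFromZero hu0 hu]
    rw [hre]; exact hl
  have hinv : MemLp (fun ξ : ℝ => ((l : ℂ) + ((2 * π * ξ : ℝ) : ℂ) * Complex.I)⁻¹) 2 := by
    have hne : ∀ ξ : ℝ, (l : ℂ) + ((2 * π * ξ : ℝ) : ℂ) * Complex.I ≠ 0 := fun ξ h => by
      have := hre ξ
      rw [h, Complex.zero_re] at this
      linarith
    rw [memLp_two_iff_integrable_sq_norm]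
    · have h1 : Integrable fun ξ : ℝ => (l ^ 2)⁻¹ * (1 + ((2 * π / l) * ξ) ^ 2)⁻¹ :=
        (integrable_inv_one_add_sq.comp_mul_left' (by positivity)).const_mul _
      refine h1.congr (Eventually.of_forall fun ξ => ?_)
      simp only [norm_inv, inv_pow]
      rw [← Complex.normSq_eq_norm_sq, Complex.normSq_add_mul_I, ← mul_inv]
      congr 1
      field_simp
    · exact (Continuous.inv₀ (by fun_prop) hne).aestronglyMeasurable
  have := hinv.integrable_mul hF2
  refine this.congr (Eventually.of_forall fun ξ => ?_)
  simp only [Pi.mul_apply]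
  rw [hF, inv_mul_cancel_left₀]
  intro h
  have h2 := hre ξ
  rw [h, Complex.zero_re] at h2
  linarith

theorem integrable_laplaceTransform_vertical {u : ℝ → ℂ} (hu0 : ∀ v ≤ 0, u v = 0)
    (hu : Integrable u) (hu2 : MemLp u 2) {l : ℝ} (hl : 0 < l) :
    Integrable fun ν : ℝ => laplaceTransform (primitiveFromZero u) (l + ν * Complex.I) := by
  have h2π : (2 * π)⁻¹ ≠ (0 : ℝ) := by positivity
  have := (integrable_laplaceTransform_line hu0 hu hu2 hl).comp_mul_left' h2π
  refine this.congr (Eventually.of_forall fun ν => ?_)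
  simp only
  rw [mul_inv_cancel_left₀ (by positivity)]

theorem integrable_primitiveFromZero_mul_exp {u : ℝ → ℂ} (hu0 : ∀ v ≤ 0, u v = 0)
    (hu : Integrable u) {l : ℝ} (hl : 0 < l) :
    Integrable (fun v : ℝ => primitiveFromZero u v * (Real.exp (-l * v) : ℂ)) := by
  have h1 := integrableOn_primitiveFromZero_mul_cexp hu (z := (l : ℂ)) (by simpa using hl)
  rw [← integrable_indicator_iff measurableSet_Ioi] at h1
  refine h1.congr (Eventually.of_forall fun v => ?_)
  by_cases hv : 0 < v
  · simp [hv]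
  · simp [hv, primitiveFromZero_of_nonpos hu0 (not_lt.1 hv)]

/-- Inversion of the Laplace transform along a vertical line. -/
theorem primitiveFromZero_eq_integral {u : ℝ → ℂ} (hu0 : ∀ v ≤ 0, u v = 0)
    (hu : Integrable u) (hu2 : MemLp u 2) {l : ℝ} (hl : 0 < l) (v : ℝ) :
    primitiveFromZero u v = Complex.exp (l * v) / (2 * π) *
      ∫ ν : ℝ, laplaceTransform (primitiveFromZero u) (l + ν * Complex.I) *
        Complex.exp (Complex.I * ν * v) := by
  set gt := laplaceTransform (primitiveFromZero u)
  set h : ℝ → ℂ := fun v => primitiveFromZero u v * (Real.exp (-l * v) : ℂ) with hh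
  have hJ := continuous_primitiveFromZero hu
  have hF : 𝓕 h = fun ξ : ℝ => gt ((l : ℂ) + ((2 * π * ξ : ℝ) : ℂ) * Complex.I) := by
    ext ξ
    exact fourier_eq_laplaceTransform (fun v hv => primitiveFromZero_of_nonpos hu0 hv) l ξ
  have hinv := congrFun (Continuous.fourierInv_fourier_eq (f := h) (by fun_prop)
    (integrable_primitiveFromZero_mul_exp hu0 hu hl)
    (by rw [hF]; exact integrable_laplaceTransform_line hu0 hu hu2 hl)) v
  rw [hF, Real.fourierInv_eq'] at hinv
  -- The substitution ν = 2πξ passes from the normalisation of `𝓕` to that of the Laplace variable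
  -- and produces the factor 1/(2π).
  have hscale := Measure.integral_comp_mul_left
    (fun ν : ℝ => gt (l + ν * Complex.I) * Complex.exp (Complex.I * ν * v)) (2 * π)
  have h1 : ∫ ξ : ℝ, Complex.exp (((2 * π * inner ℝ ξ v : ℝ) : ℂ) * Complex.I) •
      gt ((l : ℂ) + ((2 * π * ξ : ℝ) : ℂ) * Complex.I) =
      ∫ ξ : ℝ, gt (l + ((2 * π * ξ : ℝ) : ℂ) * Complex.I) *
        Complex.exp (Complex.I * ((2 * π * ξ : ℝ) : ℂ) * v) := by
    refine integral_congr_ae (Eventually.of_forall fun ξ => ?_)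
    simp only [smul_eq_mul]
    rw [mul_comm]
    congr 2
    rw [RCLike.inner_apply, conj_trivial]
    push_cast
    ring
  rw [h1, hscale, abs_of_pos (by positivity)] at hinv
  have hpi : (π : ℂ) ≠ 0 := Complex.ofReal_ne_zero.2 Real.pi_ne_zero
  have h2 : primitiveFromZero u v = Complex.exp (l * v) * h v := by
    rw [hh]
    simp only
    rw [mul_left_comm, Complex.ofReal_exp, ← Complex.exp_add]
    simp
  rw [h2, ← hinv, Complex.real_smul]
  push_cast
  ring

/-- Plancherel's equality for the Laplace transform along a vertical line. -/
theorem laplaceTransform_plancherel {u : ℝ → ℂ} (hu0 : ∀ v ≤ 0, u v = 0)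
    (hu : Integrable u) {l : ℝ} (hl : 0 < l) :
    Integrable (fun ν : ℝ => ‖laplaceTransform (primitiveFromZero u) (l + ν * Complex.I)‖ ^ 2) ∧
    IntegrableOn (fun v : ℝ => ‖primitiveFromZero u v * Real.exp (-l * v)‖ ^ 2) (Ioi 0) ∧
    ∫ ν : ℝ, ‖laplaceTransform (primitiveFromZero u) (l + ν * Complex.I)‖ ^ 2 =
      2 * π * ∫ v in Ioi (0 : ℝ), ‖primitiveFromZero u v * Real.exp (-l * v)‖ ^ 2 := by
  set gt := laplaceTransform (primitiveFromZero u)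
  set h : ℝ → ℂ := fun v => primitiveFromZero u v * (Real.exp (-l * v) : ℂ) with hh
  have h1 : Integrable h := integrable_primitiveFromZero_mul_exp hu0 hu hl
  have h0 : ∀ v ≤ 0, h v = 0 := fun v hv => by
    simp [hh, primitiveFromZero_of_nonpos hu0 hv]
  have hbd : ∀ v, ‖h v‖ ≤ ∫ s, ‖u s‖ := by
    intro v
    rcases le_or_gt v 0 with hv | hv
    · rw [h0 v hv, norm_zero]
      exact integral_nonneg fun _ => norm_nonneg _
    · rw [hh, norm_mul, Complex.norm_real, Real.norm_eq_abs, Real.abs_exp]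
      refine (mul_le_of_le_one_right (norm_nonneg _) (Real.exp_le_one_iff.2 (by nlinarith))).trans
        (norm_primitiveFromZero_le hu v)
  -- An integrable function that is bounded is square integrable.
  have h2 : MemLp h 2 := by
    rw [memLp_two_iff_integrable_sq_norm h1.1]
    refine (h1.norm.const_mul (∫ s, ‖u s‖)).mono' (h1.1.norm.pow 2)
      (Eventually.of_forall fun v => ?_)
    rw [Real.norm_of_nonneg (by positivity), sq]
    gcongr
    exact hbd v
  have hF : 𝓕 h = fun ξ : ℝ => gt ((l : ℂ) + ((2 * π * ξ : ℝ) : ℂ) * Complex.I) := by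
    ext ξ
    exact fourier_eq_laplaceTransform (fun v hv => primitiveFromZero_of_nonpos hu0 hv) l ξ
  obtain ⟨hm, heq⟩ := memLp_two_fourier h1 h2
  rw [hF] at hm heq
  have hsq := (memLp_two_iff_integrable_sq_norm hm.1).1 hm
  have h2π : (2 * π)⁻¹ ≠ (0 : ℝ) := by positivity
  refine ⟨?_, ?_, ?_⟩
  · refine (hsq.comp_mul_left' h2π).congr (Eventually.of_forall fun ν => ?_)
    simp only
    rw [mul_inv_cancel_left₀ (by positivity)]
  · exact ((memLp_two_iff_integrable_sq_norm h2.1).1 h2).integrableOn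
  · have hscale := Measure.integral_comp_mul_left
      (fun ν : ℝ => ‖gt (l + ν * Complex.I)‖ ^ 2) (2 * π)
    rw [abs_of_pos (by positivity), smul_eq_mul] at hscale
    have hset : ∫ v in Ioi (0 : ℝ), ‖h v‖ ^ 2 = ∫ v, ‖h v‖ ^ 2 := by
      refine setIntegral_eq_integral_of_forall_compl_eq_zero fun v hv => ?_
      rw [h0 v (not_lt.1 hv)]; simp
    rw [hset, ← heq, hscale, mul_inv_cancel_left₀ (by positivity)]

end LineFourier

/-! ### The logarithmic kernel: bounds, holomorphy, continuity at the branch point. -/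

section LogKernel

/-- The integral of `u` against the kernel `log (1 - e^{-s} q)`. -/
noncomputable def logIntegral (u : ℝ → ℂ) (q : ℂ) : ℂ :=
  ∫ s, u s * Complex.log (1 - Real.exp (-s) * q)

/-- The truncated square-root singularity. -/
noncomputable def truncInvSqrt : ℝ → ℝ := (Ioo (-1 : ℝ) 1).indicator fun t => |t| ^ (-(1 / 2) : ℝ)

theorem truncInvSqrt_nonneg (t : ℝ) : 0 ≤ truncInvSqrt t :=
  indicator_nonneg (fun _ _ => by positivity) _

theorem integrable_truncInvSqrt : Integrable truncInvSqrt := by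
  unfold truncInvSqrt
  rw [integrable_indicator_iff measurableSet_Ioo]
  have h1 : IntervalIntegrable (fun t : ℝ => |t| ^ (-(1 / 2) : ℝ)) volume 0 1 := by
    have : IntervalIntegrable (fun t : ℝ => t ^ (-(1 / 2) : ℝ)) volume 0 1 :=
      intervalIntegral.intervalIntegrable_rpow' (by norm_num)
    refine this.congr fun t ht => ?_
    rw [uIoc_of_le zero_le_one] at ht
    simp only [abs_of_pos ht.1]
  have h2 : IntervalIntegrable (fun t : ℝ => |t| ^ (-(1 / 2) : ℝ)) volume (-1) 0 := by
    have := (h1.comp_mul_left (c := -1)).symm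
    simpa using this
  exact ((intervalIntegrable_iff_integrableOn_Ioo_of_le (by norm_num)).1 (h2.trans h1))

/-- Weighted inequality of arithmetic and geometric means for the singular factor. -/
theorem mul_rpow_neg_quarter_le {a η : ℝ} (ha : 0 ≤ a) (hη : 0 < η) (t : ℝ) :
    a * |t| ^ (-(1 / 4) : ℝ) ≤ a + η⁻¹ * a ^ 2 + η * truncInvSqrt t := by
  have h0 := truncInvSqrt_nonneg t
  by_cases ht : t ∈ Ioo (-1 : ℝ) 1
  · rw [truncInvSqrt, indicator_of_mem ht]
    set b := |t| ^ (-(1 / 4) : ℝ)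
    have hb : |t| ^ (-(1 / 2) : ℝ) = b ^ 2 := by
      rw [← Real.rpow_natCast, ← Real.rpow_mul (abs_nonneg t)]; norm_num
    rw [hb]
    -- The exponent 1/4 is used so that b², with exponent 1/2, is still integrable; expanding this
    -- square bounds 2ab.
    have h1 : 0 ≤ η⁻¹ * (a - η * b) ^ 2 := by positivity
    have h2 : η⁻¹ * (a - η * b) ^ 2 = η⁻¹ * a ^ 2 - 2 * (a * b) + η * b ^ 2 := by
      field_simp; ring
    have h3 : 0 ≤ η⁻¹ * a ^ 2 := by positivity
    have h4 : 0 ≤ η * b ^ 2 := by positivity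
    linarith
  · have h1 : 1 ≤ |t| := by
      by_contra h
      exact ht (abs_lt.1 (not_le.1 h))
    have h2 : |t| ^ (-(1 / 4) : ℝ) ≤ 1 := Real.rpow_le_one_of_one_le_of_nonpos h1 (by norm_num)
    have h3 : a * |t| ^ (-(1 / 4) : ℝ) ≤ a := mul_le_of_le_one_right ha h2
    have : 0 ≤ η⁻¹ * a ^ 2 + η * truncInvSqrt t := by positivity
    linarith

theorem log_one_add_div_le {t : ℝ} (ht : 0 < t) :
    Real.log ((1 + t) / t) ≤ Real.log 2 + 4 * t ^ (-(1 / 4) : ℝ) := by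
  rcases le_or_gt 1 t with h | h
  · have h1 : (1 + t) / t ≤ 2 := by rw [div_le_iff₀ ht]; linarith
    have h2 := Real.log_le_log (by positivity) h1
    have : 0 ≤ t ^ (-(1 / 4) : ℝ) := by positivity
    linarith
  · have h1 : (1 + t) / t ≤ 2 * t⁻¹ := by
      rw [div_eq_mul_inv]; gcongr; linarith
    have h2 := Real.log_le_log (by positivity) h1
    rw [Real.log_mul (by norm_num) (by positivity)] at h2
    have h3 := Real.log_le_rpow_div (x := t⁻¹) (by positivity) (show (0 : ℝ) < 1 / 4 by norm_num)
    rw [Real.inv_rpow ht.le, ← Real.rpow_neg ht.le] at h3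
    linarith

/-- The logarithmic kernel has a singularity weaker than a fourth root. -/
theorem norm_log_one_sub_exp_mul_le {q : ℂ} (hq : q ≠ 0) {s : ℝ} (hs : 0 < s)
    (hsy : s ≠ Real.log ‖q‖) :
    ‖Complex.log (1 - Real.exp (-s) * q)‖ ≤
      ‖q‖ + 5 + 4 * |s - Real.log ‖q‖| ^ (-(1 / 4) : ℝ) := by
  have hq0 : 0 < ‖q‖ := norm_pos_iff.2 hq
  set t := s - Real.log ‖q‖ with ht
  have ht0 : 0 < |t| := abs_pos.2 (sub_ne_zero.2 hsy)
  set w : ℂ := Real.exp (-s) * q with hw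
  have hwn : ‖w‖ = Real.exp (-t) := by
    rw [hw, norm_mul, Complex.norm_real, Real.norm_eq_abs, Real.abs_exp, ht, neg_sub,
      sub_eq_add_neg, Real.exp_add, Real.exp_log hq0, mul_comm]
  have hup : ‖1 - w‖ ≤ 1 + ‖q‖ := by
    refine (norm_sub_le _ _).trans ?_
    rw [norm_one, hw, norm_mul, Complex.norm_real, Real.norm_eq_abs, Real.abs_exp]
    have : Real.exp (-s) ≤ 1 := Real.exp_le_one_iff.2 (by linarith)
    nlinarith
  -- The reverse triangle inequality forgets the argument of q: only the distance t of s from log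
  -- |q| enters, so the bound is uniform on circles.
  have hlow : |t| / (1 + |t|) ≤ ‖1 - w‖ := by
    have h1 : |1 - Real.exp (-t)| ≤ ‖1 - w‖ := by
      have := abs_norm_sub_norm_le (1 : ℂ) w
      rwa [norm_one, hwn] at this
    refine le_trans ?_ h1
    rw [div_le_iff₀ (by positivity)]
    rcases le_or_gt 0 t with h | h
    · rw [abs_of_nonneg h, abs_of_nonneg (by
        have : Real.exp (-t) ≤ 1 := Real.exp_le_one_iff.2 (by linarith)
        linarith)]
      have h2 : Real.exp (-t) * (1 + t) ≤ 1 := by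
        have h3 := Real.add_one_le_exp t
        calc Real.exp (-t) * (1 + t) ≤ Real.exp (-t) * Real.exp t := by gcongr; linarith
          _ = 1 := by rw [← Real.exp_add]; simp
      nlinarith
    · have h3 := Real.add_one_le_exp (-t)
      rw [abs_of_neg h, abs_of_neg (by linarith)]
      nlinarith
  have hpos : 0 < ‖1 - w‖ := lt_of_lt_of_le (by positivity) hlow
  have h1 : Real.log ‖1 - w‖ ≤ ‖q‖ := by
    have := Real.log_le_log hpos hup
    have h2 := Real.log_le_sub_one_of_pos (show 0 < 1 + ‖q‖ by positivity)
    linarith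
  have h2 : -Real.log ‖1 - w‖ ≤ Real.log 2 + 4 * |t| ^ (-(1 / 4) : ℝ) := by
    refine le_trans ?_ (log_one_add_div_le ht0)
    rw [← Real.log_inv]
    refine Real.log_le_log (by positivity) ?_
    rw [inv_le_comm₀ hpos (by positivity), inv_div]
    exact hlow
  have h3 : ‖Complex.log (1 - w)‖ ≤ |Real.log ‖1 - w‖| + |Complex.arg (1 - w)| := by
    have := Complex.norm_le_abs_re_add_abs_im (Complex.log (1 - w))
    simpa [Complex.log_re, Complex.log_im] using this
  have h4 := Complex.abs_arg_le_pi (1 - w)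
  have h5 : |Real.log ‖1 - w‖| ≤ ‖q‖ + Real.log 2 + 4 * |t| ^ (-(1 / 4) : ℝ) := by
    have h6 : 0 ≤ |t| ^ (-(1 / 4) : ℝ) := by positivity
    have h7 : 0 ≤ Real.log 2 := Real.log_nonneg (by norm_num)
    rw [abs_le]; constructor <;> linarith
  linarith [Real.pi_lt_d2, Real.log_two_lt_d9]

/-- The pointwise majorant of the integrand of `logIntegral`. -/
noncomputable def logMajorant (u : ℝ → ℂ) (q : ℂ) (η s : ℝ) : ℝ :=
  (‖q‖ + 9) * ‖u s‖ + 4 * η⁻¹ * ‖u s‖ ^ 2 + 4 * η * truncInvSqrt (s - Real.log ‖q‖)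

theorem ae_norm_mul_log_le {u : ℝ → ℂ} (hu0 : ∀ s ≤ 0, u s = 0) {q : ℂ} (hq : q ≠ 0) {η : ℝ}
    (hη : 0 < η) :
    ∀ᵐ s : ℝ, ‖u s * Complex.log (1 - Real.exp (-s) * q)‖ ≤ logMajorant u q η s := by
  have : ∀ᵐ s : ℝ, s ≠ Real.log ‖q‖ := by simp [ae_iff, measure_singleton]
  filter_upwards [this] with s hs
  rw [logMajorant]
  have h0 := truncInvSqrt_nonneg (s - Real.log ‖q‖)
  rcases le_or_gt s 0 with h | h
  · rw [hu0 s h]; simp; positivity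
  · have h1 := norm_log_one_sub_exp_mul_le hq h hs
    have h2 := mul_rpow_neg_quarter_le (norm_nonneg (u s)) hη (s - Real.log ‖q‖)
    rw [norm_mul]
    have h3 := mul_le_mul_of_nonneg_left h1 (norm_nonneg (u s))
    nlinarith

theorem integrable_logMajorant {u : ℝ → ℂ} (hu : Integrable u) (hu2 : MemLp u 2) (q : ℂ) (η : ℝ) :
    Integrable (logMajorant u q η) :=
  ((hu.norm.const_mul _).add
    (((memLp_two_iff_integrable_sq_norm hu.1).1 hu2).const_mul _)).add
      ((integrable_truncInvSqrt.comp_sub_right _).const_mul _)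

theorem integral_logMajorant {u : ℝ → ℂ} (hu : Integrable u) (hu2 : MemLp u 2) (q : ℂ) (η : ℝ) :
    ∫ s, logMajorant u q η s = (‖q‖ + 9) * (∫ s, ‖u s‖) + 4 * η⁻¹ * (∫ s, ‖u s‖ ^ 2) +
      4 * η * ∫ t, truncInvSqrt t := by
  have hsq := (memLp_two_iff_integrable_sq_norm hu.1).1 hu2
  have h1 : Integrable fun s => (‖q‖ + 9) * ‖u s‖ := hu.norm.const_mul _
  have h2 : Integrable fun s => 4 * η⁻¹ * ‖u s‖ ^ 2 := hsq.const_mul _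
  have h12 : Integrable fun s => (‖q‖ + 9) * ‖u s‖ + 4 * η⁻¹ * ‖u s‖ ^ 2 := h1.add h2
  have h3 : Integrable fun s => 4 * η * truncInvSqrt (s - Real.log ‖q‖) :=
    (integrable_truncInvSqrt.comp_sub_right _).const_mul _
  unfold logMajorant
  rw [integral_add h12 h3, integral_add h1 h2, integral_const_mul, integral_const_mul,
    integral_const_mul, integral_sub_right_eq_self]

theorem aestronglyMeasurable_mul_log {u : ℝ → ℂ} (hu : Integrable u) (q : ℂ) :
    AEStronglyMeasurable (fun s : ℝ => u s * Complex.log (1 - Real.exp (-s) * q)) := by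
  refine hu.1.mul (Measurable.aestronglyMeasurable ?_)
  fun_prop

theorem integrable_mul_log {u : ℝ → ℂ} (hu0 : ∀ s ≤ 0, u s = 0) (hu : Integrable u)
    (hu2 : MemLp u 2) {q : ℂ} (hq : q ≠ 0) :
    Integrable fun s : ℝ => u s * Complex.log (1 - Real.exp (-s) * q) :=
  (integrable_logMajorant hu hu2 q 1).mono' (aestronglyMeasurable_mul_log hu q)
    (ae_norm_mul_log_le hu0 hq one_pos)

/-- The free parameter η makes the last term small independently of u; the norms of u can then be
made small by restricting u to a short interval. -/
theorem norm_logIntegral_le {u : ℝ → ℂ} (hu0 : ∀ s ≤ 0, u s = 0) (hu : Integrable u)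
    (hu2 : MemLp u 2) {q : ℂ} (hq : q ≠ 0) {η : ℝ} (hη : 0 < η) :
    ‖logIntegral u q‖ ≤ (‖q‖ + 9) * (∫ s, ‖u s‖) + 4 * η⁻¹ * (∫ s, ‖u s‖ ^ 2) +
      4 * η * ∫ t, truncInvSqrt t := by
  rw [← integral_logMajorant hu hu2]
  exact norm_integral_le_of_norm_le (integrable_logMajorant hu hu2 q η)
    (ae_norm_mul_log_le hu0 hq hη)

/-- The slit plane is star-shaped about 1. Control at the largest relevant value of e^{-s} therefore
extends to all smaller ones. -/
theorem one_sub_mul_mem_slitPlane {q : ℂ} (hq : 1 - q ∈ Complex.slitPlane) {x : ℝ} (hx0 : 0 ≤ x)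
    (hx1 : x ≤ 1) : 1 - x * q ∈ Complex.slitPlane := by
  have := Complex.starConvex_one_slitPlane hq (sub_nonneg.2 hx1) hx0 (by ring)
  convert this using 1
  simp only [Complex.real_smul]
  push_cast
  ring

/-- If `u` vanishes on `(-∞, δ]`, then `logIntegral u` is holomorphic off the ray
`[e^δ, ∞)`. -/
theorem differentiableAt_logIntegral {u : ℝ → ℂ} {δ : ℝ} (hu0 : ∀ s ≤ δ, u s = 0)
    (hu : Integrable u) {q₀ : ℂ} (hq₀ : 1 - Real.exp (-δ) * q₀ ∈ Complex.slitPlane) :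
    DifferentiableAt ℂ (logIntegral u) q₀ := by
  have hopen : IsOpen {q : ℂ | 1 - Real.exp (-δ) * q ∈ Complex.slitPlane} :=
    Complex.isOpen_slitPlane.preimage (by fun_prop)
  obtain ⟨r, hr0, hr⟩ := Metric.nhds_basis_closedBall.mem_iff.1 (hopen.mem_nhds hq₀)
  set D := Icc (0 : ℝ) 1 ×ˢ Metric.closedBall q₀ r
  -- Writing e^{-s} = x e^{-δ} with x in [0,1] turns the unbounded range of s into a compact one, so
  -- kernel and derivative are bounded uniformly in s.
  have hD : IsCompact D := isCompact_Icc.prod (isCompact_closedBall _ _)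
  have hslit : ∀ x ∈ Icc (0 : ℝ) 1, ∀ q ∈ Metric.closedBall q₀ r,
      1 - ((x * Real.exp (-δ) : ℝ) : ℂ) * q ∈ Complex.slitPlane := by
    intro x hx q hq
    have := one_sub_mul_mem_slitPlane (hr hq) hx.1 hx.2
    rwa [← mul_assoc, ← Complex.ofReal_mul] at this
  have hc1 : ContinuousOn (fun p : ℝ × ℂ =>
      Complex.log (1 - ((p.1 * Real.exp (-δ) : ℝ) : ℂ) * p.2)) D :=
    ContinuousOn.clog (by fun_prop) fun p hp => hslit p.1 hp.1 p.2 hp.2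
  have hc2 : ContinuousOn (fun p : ℝ × ℂ => -((p.1 * Real.exp (-δ) : ℝ) : ℂ) /
      (1 - ((p.1 * Real.exp (-δ) : ℝ) : ℂ) * p.2)) D :=
    ContinuousOn.div (by fun_prop) (by fun_prop) fun p hp =>
      Complex.slitPlane_ne_zero (hslit p.1 hp.1 p.2 hp.2)
  obtain ⟨C1, hC1⟩ := hD.exists_bound_of_continuousOn hc1
  obtain ⟨C2, hC2⟩ := hD.exists_bound_of_continuousOn hc2
  have hx : ∀ s : ℝ, δ < s → Real.exp (δ - s) ∈ Icc (0 : ℝ) 1 ∧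
      Real.exp (δ - s) * Real.exp (-δ) = Real.exp (-s) := fun s hs =>
    ⟨⟨(Real.exp_pos _).le, Real.exp_le_one_iff.2 (by linarith)⟩, by
      rw [← Real.exp_add]; congr 1; ring⟩
  have hq₀m : q₀ ∈ Metric.closedBall q₀ r := Metric.mem_closedBall_self hr0.le
  refine (hasDerivAt_integral_of_dominated_loc_of_deriv_le
    (F := fun q s => u s * Complex.log (1 - Real.exp (-s) * q)) (x₀ := q₀)
    (s := Metric.closedBall q₀ r)
    (F' := fun q s => u s * (-(Real.exp (-s) : ℂ) / (1 - Real.exp (-s) * q)))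
    (bound := fun s => C2 * ‖u s‖) (Metric.closedBall_mem_nhds _ hr0)
    (Eventually.of_forall fun q => aestronglyMeasurable_mul_log hu q) ?_ ?_ ?_
    (hu.norm.const_mul C2) ?_).2.differentiableAt
  · refine (hu.norm.const_mul C1).mono' (aestronglyMeasurable_mul_log hu q₀)
      (Eventually.of_forall fun s => ?_)
    rcases le_or_gt s δ with h | h
    · simp [hu0 s h]
    · have := hC1 (Real.exp (δ - s), q₀) ⟨(hx s h).1, hq₀m⟩
      simp only [(hx s h).2] at this
      rw [norm_mul, mul_comm]
      gcongr
  · refine hu.1.mul (Measurable.aestronglyMeasurable ?_)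
    fun_prop
  · refine Eventually.of_forall fun s q hq => ?_
    rcases le_or_gt s δ with h | h
    · simp [hu0 s h]
    · have := hC2 (Real.exp (δ - s), q) ⟨(hx s h).1, hq⟩
      simp only [(hx s h).2] at this
      rw [norm_mul, mul_comm]
      gcongr
  · refine Eventually.of_forall fun s q hq => ?_
    rcases le_or_gt s δ with h | h
    · simp only [hu0 s h, zero_mul]
      exact hasDerivAt_const _ _
    · refine HasDerivAt.const_mul _ ?_
      have h1 := hslit _ (hx s h).1 q hq
      rw [(hx s h).2] at h1
      have h2 : HasDerivAt (fun q : ℂ => 1 - (Real.exp (-s) : ℂ) * q) (-(Real.exp (-s) : ℂ)) q := by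
        simpa using ((hasDerivAt_id q).const_mul (Real.exp (-s) : ℂ)).const_sub 1
      exact h2.clog h1

/-- `logIntegral u` is continuous at the branch point `1`. -/
theorem continuousAt_logIntegral_one {u : ℝ → ℂ} (hu0 : ∀ s ≤ 0, u s = 0) (hu : Integrable u)
    (hu2 : MemLp u 2) : ContinuousAt (logIntegral u) 1 := by
  refine continuousAt_of_locally_uniform_approx_of_continuousAt fun V hV => ?_
  obtain ⟨ε, hε, hεV⟩ := Metric.mem_uniformity_dist.1 hV
  set I₀ := ∫ t, truncInvSqrt t
  have hI₀ : 0 ≤ I₀ := integral_nonneg truncInvSqrt_nonneg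
  -- With this choice 4ηI₀ ≤ ε/2; then δ makes the remaining terms less than ε/2. The 11 below is 9
  -- + 2, because only |q| < 2 is considered.
  set η := ε / (8 * (I₀ + 1)) with hη
  have hη0 : 0 < η := by positivity
  have hsq := (memLp_two_iff_integrable_sq_norm hu.1).1 hu2
  have hlim : Tendsto (fun δ : ℝ => 11 * (∫ s in (0 : ℝ)..δ, ‖u s‖) +
      4 * η⁻¹ * ∫ s in (0 : ℝ)..δ, ‖u s‖ ^ 2) (𝓝[>] 0) (𝓝 0) := by
    have h1 := (intervalIntegral.continuous_primitive
      (fun _ _ => hu.norm.intervalIntegrable) 0).tendsto 0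
    have h2 := (intervalIntegral.continuous_primitive
      (fun _ _ => hsq.intervalIntegrable) 0).tendsto 0
    simp only [intervalIntegral.integral_same] at h1 h2
    simpa using ((h1.const_mul 11).add (h2.const_mul (4 * η⁻¹))).mono_left nhdsWithin_le_nhds
  obtain ⟨δ, hδε, hδ0⟩ := ((hlim.eventually (gt_mem_nhds (half_pos hε))).and
    self_mem_nhdsWithin).exists
  have hδ0 : 0 < δ := hδ0
  -- The part of u beyond δ has its branch point at e^δ > 1, so its integral is continuous at 1; the
  -- part up to δ contributes less than ε near 1.
  set a : ℝ → ℂ := (Ioi δ).indicator u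
  set b : ℝ → ℂ := (Iic δ).indicator u
  have hab : ∀ s, u s = a s + b s := fun s => by
    by_cases h : s ≤ δ
    · simp [a, b, h]
    · simp [a, b, h, not_le.1 h]
  have hai : Integrable a := hu.indicator measurableSet_Ioi
  have ha2 : MemLp a 2 := hu2.indicator measurableSet_Ioi
  have hbi : Integrable b := hu.indicator measurableSet_Iic
  have hb2 : MemLp b 2 := hu2.indicator measurableSet_Iic
  have hb0 : ∀ s ≤ 0, b s = 0 := fun s hs => by
    simp [b, indicator, hu0 s hs]
  have ha0 : ∀ s ≤ δ, a s = 0 := fun s hs => by simp [a, hs]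
  have hprim : ∀ φ : ℂ → ℝ, φ 0 = 0 → ∫ s, φ (b s) = ∫ s in (0 : ℝ)..δ, φ (u s) := by
    intro φ hφ
    rw [intervalIntegral.integral_of_le hδ0.le, ← integral_indicator measurableSet_Ioc]
    congr 1
    ext s
    by_cases h1 : s ≤ δ
    · by_cases h2 : 0 < s
      · simp [b, h1, h2]
      · simp [b, h2, hu0 s (not_lt.1 h2), indicator, hφ]
    · simp [b, h1, hφ]
  have hN : {q : ℂ | q ≠ 0 ∧ ‖q‖ < 2} ∈ 𝓝 (1 : ℂ) := by
    refine (isOpen_ne.inter (isOpen_lt continuous_norm continuous_const)).mem_nhds ?_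
    constructor <;> simp
  refine ⟨_, hN, logIntegral a, ?_, fun q hq => hεV ?_⟩
  · refine (differentiableAt_logIntegral ha0 hai ?_).continuousAt
    left
    rw [mul_one, Complex.sub_re, Complex.one_re, Complex.ofReal_re]
    have : Real.exp (-δ) < 1 := by simpa using hδ0
    linarith
  · have hq0 : q ≠ 0 := hq.1
    have hq2 : ‖q‖ < 2 := hq.2
    have hsum : logIntegral u q = logIntegral a q + logIntegral b q := by
      unfold logIntegral
      rw [← integral_add (integrable_mul_log (fun s hs => ha0 s (hs.trans hδ0.le)) hai ha2 hq0)
        (integrable_mul_log hb0 hbi hb2 hq0)]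
      simp only [hab, add_mul]
    rw [hsum, dist_eq_norm, add_sub_cancel_left]
    refine (norm_logIntegral_le hb0 hbi hb2 hq0 hη0).trans_lt ?_
    rw [hprim (fun z => ‖z‖) (by simp), hprim (fun z => ‖z‖ ^ 2) (by simp)]
    have h1 : 0 ≤ ∫ s in (0 : ℝ)..δ, ‖u s‖ :=
      intervalIntegral.integral_nonneg hδ0.le fun _ _ => norm_nonneg _
    have h2 : 4 * η * I₀ ≤ ε / 2 := by
      rw [hη]
      have : 4 * (ε / (8 * (I₀ + 1))) * I₀ = ε / 2 * (I₀ / (I₀ + 1)) := by field_simp; ring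
      rw [this]
      have h3 : I₀ / (I₀ + 1) ≤ 1 := div_le_one_of_le₀ (by linarith) (by positivity)
      nlinarith
    have h3 : (‖q‖ + 9) * (∫ s in (0 : ℝ)..δ, ‖u s‖) ≤ 11 * ∫ s in (0 : ℝ)..δ, ‖u s‖ := by
      gcongr; linarith
    linarith

end LogKernel

/-! ### The trigonometric series on the closed lower half-plane. -/

section Series

theorem integrable_mul_exp_pow {u : ℝ → ℂ} (hu0 : ∀ s ≤ 0, u s = 0) (hu : Integrable u) {q : ℂ}
    (hq : ‖q‖ ≤ 1) (k : ℕ) :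
    Integrable (fun s : ℝ => u s * ((Real.exp (-s) * q) ^ k / k)) ∧
      ∀ s : ℝ, ‖u s * ((Real.exp (-s) * q) ^ k / k)‖ ≤ ‖u s‖ * (Real.exp (-s) ^ k / k) := by
  have hle : ∀ s : ℝ, ‖u s * ((Real.exp (-s) * q) ^ k / k)‖ ≤ ‖u s‖ * (Real.exp (-s) ^ k / k) := by
    intro s
    rw [norm_mul, norm_div, norm_pow, norm_mul, Complex.norm_real, Real.norm_eq_abs, Real.abs_exp,
      Complex.norm_natCast]
    gcongr
    exact mul_le_of_le_one_right (Real.exp_pos _).le hq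
  refine ⟨hu.norm.mono' (hu.1.mul (Continuous.aestronglyMeasurable (by fun_prop)))
    (Eventually.of_forall fun s => ?_), hle⟩
  rcases le_or_gt s 0 with h | h
  · simp [hu0 s h]
  · refine (hle s).trans (mul_le_of_le_one_right (norm_nonneg _) ?_)
    have h1 : Real.exp (-s) ^ k ≤ 1 :=
      pow_le_one₀ (Real.exp_pos _).le (Real.exp_le_one_iff.2 (by linarith))
    rcases Nat.eq_zero_or_pos k with rfl | hk
    · simp
    · have : (1 : ℝ) ≤ k := by exact_mod_cast hk
      exact div_le_one_of_le₀ (h1.trans this) (by positivity)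

theorem integrable_norm_mul_exp_pow {u : ℝ → ℂ} (hu0 : ∀ s ≤ 0, u s = 0) (hu : Integrable u)
    (k : ℕ) : Integrable (fun s : ℝ => ‖u s‖ * (Real.exp (-s) ^ k / k)) := by
  refine (integrable_mul_exp_pow hu0 hu (q := 1) (by simp) k).1.norm.congr
    (Eventually.of_forall fun s => ?_)
  simp only [mul_one, norm_mul, norm_div, norm_pow, Complex.norm_real, Real.norm_eq_abs,
    Real.abs_exp, Complex.norm_natCast]

/-- At q = 1 all terms of the logarithmic series are nonnegative, so their partial sums stay below
-log(1 - e^{-s}), whose product with u is integrable. This is what gives convergence on the real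
axis. -/
theorem summable_integral_norm_mul_exp_pow {u : ℝ → ℂ} (hu0 : ∀ s ≤ 0, u s = 0)
    (hu : Integrable u) (hu2 : MemLp u 2) :
    Summable fun k : ℕ => ∫ s, ‖u s‖ * (Real.exp (-s) ^ k / k) := by
  have hI := integrable_norm_mul_exp_pow hu0 hu
  have hL := (integrable_mul_log hu0 hu hu2 one_ne_zero).norm
  refine summable_of_sum_range_le (c := ∫ s, ‖u s * Complex.log (1 - Real.exp (-s) * 1)‖)
    (fun k => integral_nonneg fun s => by positivity) fun n => ?_
  rw [← integral_finsetSum _ fun k _ => hI k]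
  refine integral_mono (integrable_finsetSum _ fun k _ => hI k) hL fun s => ?_
  simp only [norm_mul, mul_one]
  rw [← Finset.mul_sum]
  rcases le_or_gt s 0 with h | h
  · simp [hu0 s h]
  · refine mul_le_mul_of_nonneg_left ?_ (norm_nonneg _)
    have hx1 : Real.exp (-s) < 1 := by simpa using h
    have hx0 := Real.exp_pos (-s)
    have h1 := Complex.hasSum_taylorSeries_neg_log (z := (Real.exp (-s) : ℂ))
      (by rw [Complex.norm_real, Real.norm_of_nonneg hx0.le]; exact hx1)
    have h2 : (1 : ℂ) - Real.exp (-s) = ((1 - Real.exp (-s) : ℝ) : ℂ) := by push_cast; rfl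
    rw [h2, ← Complex.ofReal_log (by linarith)] at h1 ⊢
    have h3 : HasSum (fun k : ℕ => Real.exp (-s) ^ k / k) (-Real.log (1 - Real.exp (-s))) := by
      rw [← Complex.hasSum_ofReal]
      push_cast at h1 ⊢
      exact h1
    rw [Complex.norm_real]
    exact (sum_le_hasSum _ (fun k _ => by positivity) h3).trans (neg_le_abs _)

theorem integral_mul_exp_pow (u : ℝ → ℂ) (q : ℂ) (k : ℕ) :
    ∫ s, u s * ((Real.exp (-s) * q) ^ k / k) =
      q ^ k / k * ∫ s, u s * Complex.exp (-(k : ℂ) * s) := by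
  rw [← integral_const_mul]
  refine integral_congr_ae (Eventually.of_forall fun s => ?_)
  have h1 : Complex.exp (-(k : ℂ) * s) = (Real.exp (-s) : ℂ) ^ k := by
    rw [Complex.ofReal_exp, ← Complex.exp_nat_mul]
    congr 1
    push_cast
    ring
  simp only [h1, mul_pow]
  ring

/-- Expansion of `logIntegral` in the closed unit disc. -/
theorem hasSum_logIntegral {u : ℝ → ℂ} (hu0 : ∀ s ≤ 0, u s = 0) (hu : Integrable u)
    (hu2 : MemLp u 2) {q : ℂ} (hq : ‖q‖ ≤ 1) :
    HasSum (fun k : ℕ => q ^ k / k * ∫ s, u s * Complex.exp (-(k : ℂ) * s)) (-logIntegral u q) := by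
  have hI := fun k => integrable_mul_exp_pow hu0 hu hq k
  have hs : Summable fun k : ℕ => ∫ s, ‖u s * ((Real.exp (-s) * q) ^ k / k)‖ := by
    refine Summable.of_nonneg_of_le (fun k => integral_nonneg fun s => norm_nonneg _) (fun k => ?_)
      (summable_integral_norm_mul_exp_pow hu0 hu hu2)
    exact integral_mono (hI k).1.norm (integrable_norm_mul_exp_pow hu0 hu k) (hI k).2
  have h1 := hasSum_integral_of_summable_integral_norm (fun k => (hI k).1) hs
  have h2 : ∫ s, ∑' k : ℕ, u s * ((Real.exp (-s) * q) ^ k / k) = -logIntegral u q := by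
    rw [logIntegral, ← integral_neg]
    refine integral_congr_ae (Eventually.of_forall fun s => ?_)
    simp only
    rcases le_or_gt s 0 with h | h
    · simp [hu0 s h]
    · have hx1 : Real.exp (-s) < 1 := by simpa using h
      have h3 : ‖(Real.exp (-s) : ℂ) * q‖ < 1 := by
        rw [norm_mul, Complex.norm_real, Real.norm_of_nonneg (Real.exp_pos _).le]
        exact (mul_le_of_le_one_right (Real.exp_pos _).le hq).trans_lt hx1
      rw [((Complex.hasSum_taylorSeries_neg_log h3).mul_left (u s)).tsum_eq, mul_neg]
  rw [h2] at h1
  simpa only [integral_mul_exp_pow] using h1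

theorem norm_logIntegral_term_le {u : ℝ → ℂ} (hu0 : ∀ s ≤ 0, u s = 0) (hu : Integrable u) {q : ℂ}
    (hq : ‖q‖ ≤ 1) (k : ℕ) :
    ‖q ^ k / k * ∫ s, u s * Complex.exp (-(k : ℂ) * s)‖ ≤
      ∫ s, ‖u s‖ * (Real.exp (-s) ^ k / k) := by
  rw [← integral_mul_exp_pow]
  exact norm_integral_le_of_norm_le (integrable_norm_mul_exp_pow hu0 hu k)
    (Eventually.of_forall (integrable_mul_exp_pow hu0 hu hq k).2)

/-- The holomorphic extension of the trigonometric series. -/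
noncomputable def trigExtension (u : ℝ → ℂ) (τ : ℂ) : ℂ :=
  -(1 / (2 * (π : ℂ))) * logIntegral u (Complex.exp (-Complex.I * τ))

theorem norm_cexp_neg_I_mul (τ : ℂ) : ‖Complex.exp (-Complex.I * τ)‖ = Real.exp τ.im := by
  rw [Complex.norm_exp]
  simp

/-- The Weierstrass test with a majorant independent of q in the closed unit disc; this covers
compact sets below the axis and real points at once. -/
theorem tendstoUniformlyOn_trigPartialSum {g : ℕ → ℂ} {u : ℝ → ℂ} (hu0 : ∀ s ≤ 0, u s = 0)
    (hu : Integrable u) (hu2 : MemLp u 2)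
    (hg : ∀ k : ℕ, ∫ s, u s * Complex.exp (-(k : ℂ) * s) = k * g k) :
    TendstoUniformlyOn (trigPartialSum g) (trigExtension u) atTop {τ : ℂ | τ.im ≤ 0} := by
  set c : ℕ → ℂ → ℂ := fun k τ => 1 / (2 * (π : ℂ)) *
    (Complex.exp (-Complex.I * τ) ^ k / k * ∫ s, u s * Complex.exp (-(k : ℂ) * s)) with hc
  have hq : ∀ τ : ℂ, τ.im ≤ 0 → ‖Complex.exp (-Complex.I * τ)‖ ≤ 1 := fun τ hτ => by
    rw [norm_cexp_neg_I_mul]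
    exact Real.exp_le_one_iff.2 hτ
  have hsum := (summable_integral_norm_mul_exp_pow hu0 hu hu2).mul_left ‖1 / (2 * (π : ℂ))‖
  have hun := tendstoUniformlyOn_tsum_nat (f := c) hsum (s := {τ : ℂ | τ.im ≤ 0})
    fun k τ hτ => by
      rw [hc, norm_mul]
      exact mul_le_mul_of_nonneg_left (norm_logIntegral_term_le hu0 hu (hq τ hτ) k) (norm_nonneg _)
  have hG : ∀ τ ∈ {τ : ℂ | τ.im ≤ 0}, ∑' k, c k τ = trigExtension u τ := fun τ hτ => by
    rw [((hasSum_logIntegral hu0 hu hu2 (hq τ hτ)).mul_left (1 / (2 * (π : ℂ)))).tsum_eq,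
      trigExtension]
    ring
  have hpart : ∀ n τ, ∑ k ∈ Finset.range (n + 1), c k τ = trigPartialSum g n τ := by
    intro n τ
    rw [trigPartialSum, Finset.range_eq_Ico, Finset.sum_eq_sum_Ico_succ_bot (Nat.succ_pos n),
      Finset.mul_sum]
    -- The term k = 0 vanishes because division by zero gives zero.
    have h0 : c 0 τ = 0 := by simp [hc]
    rw [h0, zero_add]
    refine Finset.sum_congr (by ext; simp) fun k hk => ?_
    have hk1 : (k : ℂ) ≠ 0 := by
      have := (Finset.mem_Icc.1 hk).1
      exact Nat.cast_ne_zero.2 (by omega)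
    simp only [hc]
    rw [hg, ← Complex.exp_nat_mul, show -Complex.I * k * τ = k * (-Complex.I * τ) by ring]
    field_simp
  intro V hV
  have := (tendsto_add_atTop_nat 1).eventually (hun V hV)
  filter_upwards [this] with n hn τ hτ
  have h := hn τ hτ
  rwa [hG τ hτ, hpart] at h

end Series

/-! ### Holomorphy and continuity off the cuts. -/

section Cuts

theorem one_sub_exp_mem_slitPlane_of_notMem_cuts {τ : ℂ} (hτ : τ ∉ closedUpperCuts (2 * π)) :
    1 - Complex.exp (-Complex.I * τ) ∈ Complex.slitPlane := by
  by_contra h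
  rw [Complex.mem_slitPlane_iff, not_or, not_lt, not_not] at h
  obtain ⟨h1, h2⟩ := h
  set q := Complex.exp (-Complex.I * τ) with hq
  have hre : 1 ≤ q.re := by
    rw [Complex.sub_re, Complex.one_re] at h1; linarith
  have him : q.im = 0 := by
    rw [Complex.sub_im, Complex.one_im] at h2; linarith
  have hqr : q = ((q.re : ℝ) : ℂ) := Complex.ext rfl (by simp [him])
  -- Leaving the slit plane forces q to be real and at least 1; taking logarithms puts τ on a cut at
  -- height log q.
  have hexp : Complex.exp (-Complex.I * τ) = Complex.exp ((Real.log q.re : ℝ) : ℂ) := by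
    rw [← Complex.ofReal_exp, Real.exp_log (by linarith), ← hqr]
  obtain ⟨n, hn⟩ := Complex.exp_eq_exp_iff_exists_int.1 hexp
  refine hτ ⟨-n, Real.log q.re, Real.log_nonneg hre, ?_⟩
  have : τ = Complex.I * (-Complex.I * τ) := by
    rw [← mul_assoc, mul_neg, Complex.I_mul_I]; ring
  rw [this, hn]
  push_cast
  linear_combination (2 * (n : ℂ) * π) * Complex.I_mul_I

theorem exp_eq_one_of_mem_closedUpperCuts {τ : ℂ} (h1 : τ ∈ closedUpperCuts (2 * π))
    (h2 : τ ∉ upperCuts (2 * π)) : Complex.exp (-Complex.I * τ) = 1 := by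
  obtain ⟨k, v, hv, rfl⟩ := h1
  have hv0 : v = 0 := by
    by_contra h
    exact h2 ⟨k, v, lt_of_le_of_ne hv (Ne.symm h), rfl⟩
  rw [Complex.exp_eq_one_iff]
  refine ⟨-k, ?_⟩
  rw [hv0]
  push_cast
  ring

theorem differentiableAt_trigExtension {u : ℝ → ℂ} (hu0 : ∀ s ≤ 0, u s = 0) (hu : Integrable u)
    {τ : ℂ} (hτ : τ ∉ closedUpperCuts (2 * π)) : DifferentiableAt ℂ (trigExtension u) τ := by
  have h1 : DifferentiableAt ℂ (logIntegral u) (Complex.exp (-Complex.I * τ)) :=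
    differentiableAt_logIntegral hu0 hu (by simpa using one_sub_exp_mem_slitPlane_of_notMem_cuts hτ)
  exact (DifferentiableAt.comp (g := logIntegral u) τ h1 (by fun_prop)).const_mul _

/-- The only points not covered by holomorphy are the endpoints of the cuts, and all of them map to
the branch point q = 1. -/
theorem continuousAt_trigExtension {u : ℝ → ℂ} (hu0 : ∀ s ≤ 0, u s = 0) (hu : Integrable u)
    (hu2 : MemLp u 2) {τ : ℂ} (hτ : τ ∉ upperCuts (2 * π)) :
    ContinuousAt (trigExtension u) τ := by
  by_cases h : τ ∈ closedUpperCuts (2 * π)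
  · have h1 := exp_eq_one_of_mem_closedUpperCuts h hτ
    have h2 : ContinuousAt (logIntegral u) (Complex.exp (-Complex.I * τ)) := by
      rw [h1]; exact continuousAt_logIntegral_one hu0 hu hu2
    have h3 : ContinuousAt (fun τ : ℂ => Complex.exp (-Complex.I * τ)) τ := by fun_prop
    exact continuousAt_const.mul (ContinuousAt.comp (f := fun τ : ℂ => Complex.exp (-Complex.I * τ))
      h2 h3)
  · exact (differentiableAt_trigExtension hu0 hu h).continuousAt

end Cuts

/-! ### The jump across the cuts. -/

section Jump

theorem im_one_sub_exp_mul (a ε : ℝ) :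
    (1 - (Real.exp a : ℂ) * Complex.exp (-Complex.I * ε)).im = Real.exp a * Real.sin ε := by
  rw [show -Complex.I * (ε : ℂ) = ((-ε : ℝ) : ℂ) * Complex.I by push_cast; ring, Complex.sub_im,
    Complex.im_ofReal_mul, Complex.exp_ofReal_mul_I_im, Real.sin_neg]
  simp

/-- The one-sided limits of the logarithmic kernel on its branch cut. -/
theorem tendsto_log_one_sub_exp (a : ℝ) (ha : a ≠ 0) :
    Tendsto (fun ε : ℝ => Complex.log (1 - (Real.exp a : ℂ) * Complex.exp (-Complex.I * ε)))
      (𝓝[>] 0) (𝓝 (Real.log ‖(1 - Real.exp a : ℂ)‖ + if 0 < a then π * Complex.I else 0)) ∧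
    Tendsto (fun ε : ℝ => Complex.log (1 - (Real.exp a : ℂ) * Complex.exp (-Complex.I * (-ε : ℝ))))
      (𝓝[>] 0) (𝓝 (Real.log ‖(1 - Real.exp a : ℂ)‖ - if 0 < a then π * Complex.I else 0)) := by
  set w : ℝ → ℂ := fun ε => 1 - (Real.exp a : ℂ) * Complex.exp (-Complex.I * ε) with hw
  have hwc : Continuous w := by fun_prop
  have hw0 : w 0 = ((1 - Real.exp a : ℝ) : ℂ) := by simp [hw]
  have hw0' : w 0 = 1 - (Real.exp a : ℂ) := by rw [hw0]; push_cast; rfl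
  have h1 : Tendsto w (𝓝[>] 0) (𝓝 (w 0)) := (hwc.tendsto 0).mono_left nhdsWithin_le_nhds
  have h2 : Tendsto (fun ε : ℝ => w (-ε)) (𝓝[>] 0) (𝓝 (w 0)) := by
    have : Continuous fun ε : ℝ => w (-ε) := hwc.comp continuous_neg
    simpa using (this.tendsto 0).mono_left nhdsWithin_le_nhds
  have hsin : ∀ᶠ ε : ℝ in 𝓝[>] 0, 0 < Real.sin ε := by
    filter_upwards [Ioo_mem_nhdsGT Real.pi_pos] with ε hε
    exact Real.sin_pos_of_pos_of_lt_pi hε.1 hε.2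
  rcases lt_or_gt_of_ne ha with h | h
  · have hlt : Real.exp a < 1 := Real.exp_lt_one_iff.2 h
    have hslit : w 0 ∈ Complex.slitPlane := by
      left; rw [hw0, Complex.ofReal_re]; linarith
    have hlog : Complex.log (w 0) = Real.log ‖(1 - Real.exp a : ℂ)‖ := by
      rw [← hw0', hw0, ← Complex.ofReal_log (by linarith), Complex.norm_real,
        Real.norm_of_nonneg (by linarith)]
    rw [if_neg (not_lt.2 h.le), add_zero, sub_zero, ← hlog]
    exact ⟨h1.clog hslit, h2.clog hslit⟩
  -- Here 1 - e^a lies on the branch cut. Since the imaginary part is e^a sin ε, positive ε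
  -- approaches it from above and negative ε from below, giving ±πi.
  · have hgt : 1 < Real.exp a := Real.one_lt_exp_iff.2 h
    have hre : (w 0).re < 0 := by rw [hw0, Complex.ofReal_re]; linarith
    have him : (w 0).im = 0 := by rw [hw0, Complex.ofReal_im]
    rw [if_pos h, ← hw0']
    constructor
    · refine (Complex.tendsto_log_nhdsWithin_im_nonneg_of_re_neg_of_im_zero hre him).comp
        (tendsto_nhdsWithin_iff.2 ⟨h1, ?_⟩)
      filter_upwards [hsin] with ε hε
      show 0 ≤ (w ε).im
      rw [hw, im_one_sub_exp_mul]
      positivity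
    · refine (Complex.tendsto_log_nhdsWithin_im_neg_of_re_neg_of_im_zero hre him).comp
        (tendsto_nhdsWithin_iff.2 ⟨h2, ?_⟩)
      filter_upwards [hsin] with ε hε
      show (w (-ε)).im < 0
      rw [hw, im_one_sub_exp_mul, Real.sin_neg]
      have := mul_pos (Real.exp_pos a) hε
      linarith

/-- Along the circle |q| = e^v the majorant does not move, so dominated convergence applies;
pointwise convergence is needed only off s = v. The angle θ is left general to serve both sides of
the cut. -/
theorem tendsto_logIntegral_rotate {u : ℝ → ℂ} (hu0 : ∀ s ≤ 0, u s = 0) (hu : Integrable u)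
    (hu2 : MemLp u 2) (v : ℝ) {θ : ℝ → ℝ} {K : ℝ → ℂ}
    (hK : ∀ a : ℝ, a ≠ 0 → Tendsto (fun ε : ℝ =>
      Complex.log (1 - (Real.exp a : ℂ) * Complex.exp (-Complex.I * θ ε))) (𝓝[>] 0) (𝓝 (K a))) :
    Integrable (fun s => u s * K (v - s)) ∧
    Tendsto (fun ε : ℝ => logIntegral u (Real.exp v * Complex.exp (-Complex.I * θ ε))) (𝓝[>] 0)
      (𝓝 (∫ s, u s * K (v - s))) := by
  have hn : ∀ ε : ℝ, ‖(Real.exp v : ℂ) * Complex.exp (-Complex.I * θ ε)‖ = Real.exp v := fun ε => by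
    rw [norm_mul, norm_cexp_neg_I_mul, Complex.norm_real, Real.norm_eq_abs, Real.abs_exp]
    simp
  have hne : ∀ ε : ℝ, (Real.exp v : ℂ) * Complex.exp (-Complex.I * θ ε) ≠ 0 := fun ε => by
    rw [← norm_pos_iff, hn]; exact Real.exp_pos v
  have hnv : ‖(Real.exp v : ℂ)‖ = Real.exp v := by
    rw [Complex.norm_real, Real.norm_eq_abs, Real.abs_exp]
  have hbound : ∀ ε : ℝ, ∀ᵐ s, ‖u s * Complex.log (1 - (Real.exp (-s) : ℂ) *
      ((Real.exp v : ℂ) * Complex.exp (-Complex.I * θ ε)))‖ ≤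
      logMajorant u (Real.exp v : ℂ) 1 s := fun ε => by
    have := ae_norm_mul_log_le hu0 (hne ε) one_pos
    simpa only [logMajorant, hn, hnv] using this
  have hlim : ∀ᵐ s, Tendsto (fun ε : ℝ => u s * Complex.log (1 - (Real.exp (-s) : ℂ) *
      ((Real.exp v : ℂ) * Complex.exp (-Complex.I * θ ε)))) (𝓝[>] 0) (𝓝 (u s * K (v - s))) := by
    have : ∀ᵐ s : ℝ, s ≠ v := by simp [ae_iff, measure_singleton]
    filter_upwards [this] with s hs
    refine Tendsto.const_mul _ ?_
    have h1 := hK (v - s) (sub_ne_zero.2 hs.symm)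
    have h2 : (Real.exp (v - s) : ℂ) = (Real.exp (-s) : ℂ) * Real.exp v := by
      rw [← Complex.ofReal_mul, ← Real.exp_add]; congr 2; ring
    simpa only [h2, mul_assoc] using h1
  have hmaj := integrable_logMajorant hu hu2 (Real.exp v : ℂ) 1
  have hmeas : ∀ ε : ℝ, AEStronglyMeasurable (fun s : ℝ => u s * Complex.log (1 -
      (Real.exp (-s) : ℂ) * ((Real.exp v : ℂ) * Complex.exp (-Complex.I * θ ε)))) :=
    fun ε => aestronglyMeasurable_mul_log hu _
  refine ⟨hmaj.mono' (aestronglyMeasurable_of_tendsto_ae (𝓝[>] (0 : ℝ)) hmeas hlim) ?_,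
    tendsto_integral_filter_of_dominated_convergence _ (Eventually.of_forall hmeas)
      (Eventually.of_forall hbound) hmaj hlim⟩
  obtain ⟨ε, hε⟩ := exists_seq_tendsto (𝓝[>] (0 : ℝ))
  filter_upwards [hlim, ae_all_iff.2 fun n => hbound (ε n)] with s h1 h2
  exact le_of_tendsto (h1.comp hε).norm (Eventually.of_forall h2)

/-- The jump of the extension across the cuts. -/
theorem exists_jump_trigExtension {u : ℝ → ℂ} (hu0 : ∀ s ≤ 0, u s = 0) (hu : Integrable u)
    (hu2 : MemLp u 2) (k : ℤ) {v : ℝ} (hv : 0 ≤ v) : ∃ Gr Gl : ℂ,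
      Tendsto (fun ε : ℝ => trigExtension u (2 * k * π + ε + v * Complex.I)) (𝓝[>] 0) (𝓝 Gr) ∧
      Tendsto (fun ε : ℝ => trigExtension u (2 * k * π - ε + v * Complex.I)) (𝓝[>] 0) (𝓝 Gl) ∧
      primitiveFromZero u v = Complex.I * (Gr - Gl) := by
  obtain ⟨hRi, hR⟩ := tendsto_logIntegral_rotate hu0 hu hu2 v (θ := fun ε => ε)
    (K := fun a => Real.log ‖(1 - Real.exp a : ℂ)‖ + if 0 < a then π * Complex.I else 0)
    fun a ha => (tendsto_log_one_sub_exp a ha).1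
  obtain ⟨hLi, hL⟩ := tendsto_logIntegral_rotate hu0 hu hu2 v (θ := fun ε => -ε)
    (K := fun a => Real.log ‖(1 - Real.exp a : ℂ)‖ - if 0 < a then π * Complex.I else 0)
    fun a ha => (tendsto_log_one_sub_exp a ha).2
  -- By 2π-periodicity k disappears, hence the jump is the same on every cut.
  have hexp : ∀ x : ℝ, Complex.exp (-Complex.I * (2 * k * π + x + v * Complex.I)) =
      Real.exp v * Complex.exp (-Complex.I * x) := fun x => by
    rw [Complex.ofReal_exp, ← Complex.exp_add, Complex.exp_eq_exp_iff_exists_int]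
    refine ⟨-k, ?_⟩
    push_cast
    linear_combination -(v : ℂ) * Complex.I_mul_I
  refine ⟨_, _, (hR.const_mul (-(1 / (2 * (π : ℂ))))).congr fun ε => ?_,
    (hL.const_mul (-(1 / (2 * (π : ℂ))))).congr fun ε => ?_, ?_⟩
  · rw [trigExtension, hexp]
  · rw [trigExtension, ← hexp]
    push_cast
    rw [← sub_eq_add_neg]
  · rw [← mul_sub, ← integral_sub hRi hLi]
    -- The real parts cancel; the difference of the two kernels is 2πi for s < v and 0 otherwise.
    have h1 : ∀ s, u s * (Real.log ‖(1 - Real.exp (v - s) : ℂ)‖ +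
          if 0 < v - s then π * Complex.I else 0) -
        u s * (Real.log ‖(1 - Real.exp (v - s) : ℂ)‖ -
          if 0 < v - s then π * Complex.I else 0) =
        (Ioo 0 v).indicator (fun s => u s * (2 * π * Complex.I)) s := fun s => by
      rcases le_or_gt s 0 with h | h
      · simp [hu0 s h, h]
      · by_cases hs : s < v
        · simp only [sub_pos, hs, if_true, indicator_of_mem (show s ∈ Ioo 0 v from ⟨h, hs⟩)]
          ring
        · simp [hs]
    simp only [h1]
    rw [integral_indicator measurableSet_Ioo, integral_mul_const, primitiveFromZero,
      intervalIntegral.integral_of_le hv, integral_Ioc_eq_integral_Ioo]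
    have hpi : (π : ℂ) ≠ 0 := Complex.ofReal_ne_zero.2 Real.pi_ne_zero
    field_simp
    linear_combination (∫ s in Ioo 0 v, u s) * Complex.I_sq

end Jump

/-! ### Assembly of the theorem. -/

theorem mainTheorem1 (g : ℕ → ℂ)
    (hg : HausdorffCondition 2 (fun k => (k : ℂ) * g k)) :
    ∃ (G : ℂ → ℂ) (J : ℝ → ℂ) (gt : ℂ → ℂ),
      -- `gt` is the unique Carlsonian interpolation of the coefficients
      (IsCarlsonianInterpolation (1 / 2) g gt ∧
        ∀ F : ℂ → ℂ, IsCarlsonianInterpolation (1 / 2) g F →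
          EqOn F gt {z : ℂ | 1 / 2 ≤ z.re}) ∧
      -- (1) convergence of the series, also on the real axis
      ((∀ K : Set ℂ, IsCompact K → K ⊆ {τ : ℂ | τ.im < 0} →
          TendstoUniformlyOn (trigPartialSum g) G atTop K) ∧
        DifferentiableOn ℂ G {τ : ℂ | τ.im < 0} ∧
        (∀ τ : ℂ, τ.im ≤ 0 → Tendsto (fun n => trigPartialSum g n τ) atTop (𝓝 (G τ))) ∧
        ContinuousOn G {τ : ℂ | τ.im ≤ 0}) ∧
      -- (2) holomorphic extension to the cut upper half-plane, through the real axis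
      (DifferentiableOn ℂ G (closedUpperCuts (2 * π))ᶜ ∧
        ContinuousOn G (upperCuts (2 * π))ᶜ) ∧
      -- (3) the jump function across each cut, its continuity and its bound
      ((∀ (k : ℤ) (v : ℝ), 0 ≤ v → ∃ Gr Gl : ℂ,
          Tendsto (fun ε : ℝ => G (2 * k * π + ε + v * Complex.I)) (𝓝[>] 0) (𝓝 Gr) ∧
          Tendsto (fun ε : ℝ => G (2 * k * π - ε + v * Complex.I)) (𝓝[>] 0) (𝓝 Gl) ∧
          J v = Complex.I * (Gr - Gl)) ∧
        ContinuousOn J (Ici 0) ∧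
        (∀ l : ℝ, 1 / 2 ≤ l → Integrable (fun ν : ℝ => gt (l + ν * Complex.I)) ∧
          ∀ v : ℝ, 0 ≤ v → ‖J v‖ ≤ lineNorm gt l * Real.exp (l * v))) ∧
      -- (4) growth at infinity and value at zero
      (J =o[atTop] (fun v : ℝ => Real.exp (v / 2)) ∧ J 0 = 0) ∧
      -- (5) integral representation
      (∀ v : ℝ, 0 ≤ v →
        J v = Complex.exp (v / 2) / (2 * π) *
          ∫ ν : ℝ, gt (1 / 2 + ν * Complex.I) * Complex.exp (Complex.I * ν * v)) ∧
      -- (6) Laplace transform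
      ((∀ z : ℂ, 1 / 2 < z.re →
          IntegrableOn (fun v : ℝ => J v * Complex.exp (-z * v)) (Ioi 0) ∧
          laplaceTransform J z = gt z) ∧
        DifferentiableOn ℂ (laplaceTransform J) {z : ℂ | 1 / 2 < z.re}) ∧
      -- (7) Plancherel equality
      (∀ l : ℝ, 1 / 2 ≤ l →
        Integrable (fun ν : ℝ => ‖gt (l + ν * Complex.I)‖ ^ 2) ∧
        IntegrableOn (fun v : ℝ => ‖J v * Real.exp (-l * v)‖ ^ 2) (Ioi 0) ∧
        ∫ ν : ℝ, ‖gt (l + ν * Complex.I)‖ ^ 2 =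
          2 * π * ∫ v in Ioi (0 : ℝ), ‖J v * Real.exp (-l * v)‖ ^ 2) := by
  obtain ⟨u, hu0, hu, hu2, huf⟩ := hg.exists_laplace
  set J := primitiveFromZero u with hJ
  set gt := laplaceTransform J with hgt
  set C := ∫ s, ‖u s‖
  have hJc : Continuous J := continuous_primitiveFromZero hu
  have hJC : ∀ v, ‖J v‖ ≤ C := norm_primitiveFromZero_le hu
  have hC0 : 0 ≤ C := (norm_nonneg _).trans (hJC 0)
  have hmul : ∀ z : ℂ, 0 < z.re → z * gt z = ∫ v, u v * Complex.exp (-z * v) := fun z hz =>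
    mul_laplaceTransform_primitiveFromZero hu0 hu hz
  have hdiff : ∀ z : ℂ, 0 < z.re → DifferentiableAt ℂ gt z := fun z hz =>
    differentiableAt_laplaceTransform hJc hJC hz
  -- The product z g̃(z) is bounded by the L¹ norm of u, and |z| ≥ 1/2. Boundedness gives both
  -- growth conditions of the interpolation with exponent 0.
  have hbd : ∀ z : ℂ, 1 / 2 ≤ z.re → ‖gt z‖ ≤ 2 * C := by
    intro z hz
    have hz0 : 0 < z.re := by linarith
    have h1 : ‖z * gt z‖ ≤ C := by
      rw [hmul z hz0]
      exact norm_integral_le_of_norm_le hu.norm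
        (Eventually.of_forall (integrable_mul_cexp_neg hu0 hu hz0.le).2)
    rw [norm_mul] at h1
    have h2 := Complex.re_le_norm z
    nlinarith [norm_nonneg (gt z)]
  have hcar : IsCarlsonianInterpolation (1 / 2) g gt := by
    refine ⟨fun k hk => ?_, fun z hz => ?_, fun z hz => ?_, ⟨2 * C, 0, fun z hz => ?_⟩,
      ⟨2 * C, 0, Real.pi_pos, fun y => ?_⟩⟩
    · have hk0 : (0 : ℝ) < k := by linarith
      have h1 := hmul (k : ℂ) (by simpa using hk0)
      rw [huf k] at h1
      exact mul_left_cancel₀ (Nat.cast_ne_zero.2 (by rintro rfl; simp at hk0)) h1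
    · have hz : 1 / 2 < z.re := hz
      exact (hdiff z (by linarith)).differentiableWithinAt
    · have hz : 1 / 2 ≤ z.re := hz
      exact (hdiff z (by linarith)).continuousAt.continuousWithinAt
    · simpa using hbd z hz
    · simpa using hbd (((1 / 2 : ℝ) : ℂ) + y * Complex.I) (by simp)
  have hser := tendstoUniformlyOn_trigPartialSum hu0 hu hu2 huf
  have hlow : ∀ τ : ℂ, τ.im ≤ 0 → τ ∉ upperCuts (2 * π) := by
    rintro τ hτ ⟨k, v, hv, rfl⟩
    simp at hτ
    linarith
  have hlow' : ∀ τ : ℂ, τ.im < 0 → τ ∉ closedUpperCuts (2 * π) := by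
    rintro τ hτ ⟨k, v, hv, rfl⟩
    simp at hτ
    linarith
  have hinv : ∀ {l : ℝ}, 0 < l → ∀ v : ℝ, J v = Complex.exp (l * v) / (2 * π) *
      ∫ ν : ℝ, gt (l + ν * Complex.I) * Complex.exp (Complex.I * ν * v) := fun hl v =>
    primitiveFromZero_eq_integral hu0 hu hu2 hl v
  refine ⟨trigExtension u, J, gt, ⟨hcar, fun F hF => ?_⟩, ⟨fun K _ hK => ?_, ?_, ?_, ?_⟩, ⟨?_, ?_⟩,
    ⟨fun k v hv => exists_jump_trigExtension hu0 hu hu2 k hv, hJc.continuousOn, fun l hl => ⟨?_, ?_⟩⟩,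
    ⟨?_, primitiveFromZero_of_nonpos hu0 le_rfl⟩, ?_, ⟨fun z hz => ⟨?_, rfl⟩, ?_⟩, fun l hl => ?_⟩
  · have h0 : EqOn (F - gt) 0 {z : ℂ | 1 / 2 ≤ z.re} := by
      refine carlson_eqOn_zero (hF.holomorphic.sub hcar.holomorphic)
        (hF.continuous.sub hcar.continuous) ?_ ?_ fun k hk => ?_
      · obtain ⟨A, B, hAB⟩ := hF.expType
        refine ⟨|A| + 2 * C, |B|, fun z hz => ?_⟩
        have h1 : A * Real.exp (B * ‖z‖) ≤ |A| * Real.exp (|B| * ‖z‖) := by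
          gcongr
          · exact le_abs_self A
          · exact le_abs_self B
        have h2 : (1 : ℝ) ≤ Real.exp (|B| * ‖z‖) := Real.one_le_exp (by positivity)
        calc ‖F z - gt z‖ ≤ ‖F z‖ + ‖gt z‖ := norm_sub_le _ _
          _ ≤ |A| * Real.exp (|B| * ‖z‖) + 2 * C * 1 := by
            linarith [hAB z hz, hbd z hz]
          _ ≤ |A| * Real.exp (|B| * ‖z‖) + 2 * C * Real.exp (|B| * ‖z‖) := by gcongr
          _ = _ := by ring
      · obtain ⟨A, c, hc, hA⟩ := hF.boundary
        refine ⟨|A| + 2 * C, max c 0, max_lt hc Real.pi_pos, fun y => ?_⟩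
        have h1 : A * Real.exp (c * |y|) ≤ |A| * Real.exp (max c 0 * |y|) := by
          gcongr
          · exact le_abs_self A
          · exact le_max_left c 0
        have h2 : (1 : ℝ) ≤ Real.exp (max c 0 * |y|) := Real.one_le_exp (by positivity)
        have h3 := hA y
        have h4 := hbd (((1 / 2 : ℝ) : ℂ) + y * Complex.I) (by simp)
        have h5 : (((1 / 2 : ℝ) : ℂ)) = 1 / 2 := by push_cast; rfl
        rw [h5] at h3 h4
        calc ‖F (1 / 2 + y * Complex.I) - gt (1 / 2 + y * Complex.I)‖
            ≤ ‖F (1 / 2 + y * Complex.I)‖ + ‖gt (1 / 2 + y * Complex.I)‖ := norm_sub_le _ _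
          _ ≤ |A| * Real.exp (max c 0 * |y|) + 2 * C * 1 := by linarith
          _ ≤ |A| * Real.exp (max c 0 * |y|) + 2 * C * Real.exp (max c 0 * |y|) := by gcongr
          _ = _ := by ring
      · have hk' : (1 / 2 : ℝ) < k := by
          have : (1 : ℝ) ≤ k := by exact_mod_cast hk
          linarith
        rw [Pi.sub_apply, hF.interpolates k hk', hcar.interpolates k hk', sub_self]
    intro z hz
    exact sub_eq_zero.1 (h0 hz)
  · exact hser.mono fun τ hτ => (show τ.im ≤ 0 from le_of_lt (show τ.im < 0 from hK hτ))
  · exact fun τ hτ => (differentiableAt_trigExtension hu0 hu (hlow' τ hτ)).differentiableWithinAt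
  · exact fun τ hτ => hser.tendsto_at hτ
  · exact fun τ hτ => (continuousAt_trigExtension hu0 hu hu2 (hlow τ hτ)).continuousWithinAt
  · exact fun τ hτ => (differentiableAt_trigExtension hu0 hu hτ).differentiableWithinAt
  · exact fun τ hτ => (continuousAt_trigExtension hu0 hu hu2 hτ).continuousWithinAt
  · exact integrable_laplaceTransform_vertical hu0 hu hu2 (by linarith)
  · intro v _
    rw [hinv (show 0 < l by linarith) v, norm_mul, norm_div, Complex.norm_exp, lineNorm]
    have h1 : ‖∫ ν : ℝ, gt (l + ν * Complex.I) * Complex.exp (Complex.I * ν * v)‖ ≤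
        ∫ ν : ℝ, ‖gt (l + ν * Complex.I)‖ := by
      refine (norm_integral_le_integral_norm _).trans_eq ?_
      refine integral_congr_ae (Eventually.of_forall fun ν => ?_)
      simp only [norm_mul, Complex.norm_exp]
      simp
    have h2 : ‖(2 * (π : ℂ))‖ = 2 * π := by
      rw [norm_mul, Complex.norm_real, Real.norm_of_nonneg Real.pi_pos.le]; simp
    have h3 : ((l : ℂ) * v).re = l * v := by simp
    rw [h2, h3]
    calc _ ≤ Real.exp (l * v) / (2 * π) * ∫ ν : ℝ, ‖gt (l + ν * Complex.I)‖ := by gcongr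
      _ = _ := by ring
  · have h1 : J =O[atTop] fun _ : ℝ => (1 : ℝ) :=
      IsBigO.of_bound C (Eventually.of_forall fun v => by simpa using hJC v)
    refine h1.trans_isLittleO (isLittleO_const_left.2 (Or.inr ?_))
    have h2 : Tendsto (fun v : ℝ => Real.exp (v / 2)) atTop atTop :=
      Real.tendsto_exp_atTop.comp (tendsto_id.atTop_div_const (by norm_num))
    exact tendsto_norm_atTop_atTop.comp h2
  · intro v _
    have h1 := hinv (show (0 : ℝ) < 1 / 2 by norm_num) v
    have h5 : (((1 / 2 : ℝ) : ℂ)) = 1 / 2 := by push_cast; rfl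
    rw [h5, show (1 / 2 : ℂ) * v = v / 2 by ring] at h1
    exact h1
  · exact integrableOn_primitiveFromZero_mul_cexp hu (by linarith)
  · intro z hz
    have hz : 1 / 2 < z.re := hz
    exact (hdiff z (by linarith)).differentiableWithinAt
  · exact laplaceTransform_plancherel hu0 hu (by linarith)
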